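/- **Setting.** A network coding problem $\mathsf P$ consists of finite sets $V$ of nodes, $E$ of hyperedges and $S$ of sources; each $e\in E$ has a transmit node $\mathrm{tail}(e)\in V$ and a set of receiving nodes $\mathrm{head}(e)\subseteq V$, with no directed cycles; source $s$ is available at the nodes $O(s)\subseteq V$ and is demanded by the nodes $D(s)\subseteq V$. Put $\mathrm{head}(s)=O(s)$ for $s\in S$, $\mathrm{in}(u)=\{f\in S\cup E: u\in \mathrm{head}(f)\}$ for $u\in V$, and $\mathrm{in}(e)=\mathrm{in}(\mathrm{tail}(e))$ for $e\in E$. Rate-capacity tuples are the elements $(\lambda,\omega)$ of $\chi(\mathsf P)=\mathbb R_{\ge0}^{S}\times\mathbb R_{\ge0}^{E}$. A secure problem has in addition wiretappers $r$ with sets $A_r\subseteq S$ (sources aimed at) and $B_r\subseteq E$ (hyperedges observed). For a set $R$ of tuples, $\mathsf{CL}(R)$ is the set of $(\lambda,\omega)\in\chi(\mathsf P)$ for which there are $(\lambda^n,\omega^n)\in R$ and $c_n>0$ such that the limits of $c_n\lambda^n(s)$ and $c_n\omega^n(e)$ exist and satisfy $\lim_n c_n\lambda^n(s)\ge\lambda(s)$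 for all $s$ and $\lim_n c_n\omega^n(e)\le\omega(e)$ for all $e$. For a finite set $N$, $\bar\Gamma^*(N)\subseteq\mathbb R^{2^N}$ is the set of limits of sequences of functions $h$ such that $c\,h$, for some $c>0$, is the entropy function $\alpha\mapsto H(Y_i,i\in\alpha)$ of a family of discrete random variables $(Y_i)_{i\in N}$. Write $h(\alpha\mid\beta)=h(\alpha\cup\beta)-h(\beta)$, $h(\alpha\wedge\beta)=h(\alpha)+h(\beta)-h(\alpha\cup\beta)$, and $\mathrm{proj}[h]=((h(s))_{s\in S},(h(e))_{e\in E})$. *Yeung's outer bound* for $\mathsf P$ is $\mathsf{CL}(\mathrm{proj}[\mathcal B])$, where $\mathcal B$ is the set of $h\in\bar\Gamma^*(S\cup E)$ with $h(S)=\sum_s h(s)$, $h(e\mid \mathrm{in}(e))=0$ for all $e\in E$, and $h(s\mid\mathrm{in}(u))=0$ for all $s\in S$, $u\in D(s)$. A tuple *satisfies the secure outer bound* for a secure problem if it lies in $\mathsf{CL}(\{\mathrm{proj}[h]\})$ for some $h\in\bar\Gamma^*(S\cup E\cup V)$ with $h(S\cup V)=\sum_s h(s)+\sum_{u\in V}h(u)$,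 $h(e\mid \mathrm{in}(e)\cup\{\mathrm{tail}(e)\})=0$ for all $e$, $h(s\mid\mathrm{in}(u))=0$ for all $s$ and $u\in D(s)$, and $h(A_r\wedge B_r)=0$ for all $r$. A *network code* for $\mathsf P$ is a family of finite-valued random variables $(Y_f)_{f\in S\cup E}$ such that the $Y_s$ are mutually independent and uniform on their supports and, for each $e$, $Y_e=\phi_e(Y_f: f\in\mathrm{in}(e))$ almost surely for some function $\phi_e$. The tuple $(\lambda,\omega)$ is *zero-error achievable* for $\mathsf P$ if there are network codes $(Y^n_f)$ and $c_n>0$ such that the limits below exist, with $\lim_n c_n\log|\mathsf{SP}(Y^n_s)|\ge\lambda(s)$ and $\lim_n c_n\log|\mathsf{SP}(Y^n_e)|\le\omega(e)$ ($\mathsf{SP}$ denotes the support), and $H(Y^n_s\mid Y^n_f, f\in\mathrm{in}(u))=0$ for all $n$, $s$ and $u\in D(s)$. A *stochastic network code* for a secure problem is a family $(Y_f)_{f\in S\cup E\cup V}$ with each $Y_s$ uniform on its support, whose entropy function satisfies $h(S\cup V)=\sum_s h(s)+\sum_{u\in V} h(u)$ and $h(e\mid \mathrm{in}(e)\cup\{\mathrm{tail}(e)\})=0$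 for all $e$. A tuple is *zero-error achievable under strong secrecy* if there are stochastic network codes and $c_n>0$ with the same limit and decoding conditions and with $I(Y^n_{A_r};Y^n_{B_r})=0$ for all $n$ and $r$. **Construction.** From $\mathsf P$ form the secure problem $\mathsf P^\ddagger$ as follows. Its nodes are those of $V$ and new nodes $\phi,\eta$, $\psi_s,\gamma_s$ ($s\in S$) and $\theta_{s,u},\tau_{s,u}$ ($s\in S$, $u\in D(s)$). Its hyperedges are those of $E$, with unchanged tails and heads, and new ones $a_s,b_s,c_s,e_s$ ($s\in S$) and $d_{s,u},w_{s,u}$ ($s\in S,u\in D(s)$) with - $a_s:\ \phi\to O(s)\cup\{\eta,\gamma_s\}$, $\quad b_s:\ \phi\to\{\gamma_s,\eta\}\cup\{\theta_{s,u}:u\in D(s)\}$, - $c_s:\ \gamma_s\to\{\psi_s\}$, $\quad e_s:\ \phi\to\{\psi_s\}\cup\{\tau_{s,u}:u\in D(s)\}$, - $d_{s,u}:\ u\to\{\theta_{s,u}\}$, $\quad w_{s,u}:\ \theta_{s,u}\to\{\tau_{s,u}\}$. There is a single source $1'$, available only at $\phi$ and demanded by all the nodes $\tau_{s,u}$, all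 the nodes $\psi_s$, and $\eta$. There are two wiretappers, with $A_1=A_2=\{1'\}$, $B_1=\{a_s:s\in S\}$ and $B_2=\{b_s:s\in S\}$. For $(\lambda,\omega)\in\chi(\mathsf P)$ let $(\lambda^\ddagger,\omega^\ddagger)=T^\ddagger(\lambda,\omega)$ be given by $\omega^\ddagger(e)=\omega(e)$ for $e\in E$, $\omega^\ddagger(a_s)=\omega^\ddagger(b_s)=\omega^\ddagger(c_s)=\omega^\ddagger(d_{s,u})=\omega^\ddagger(w_{s,u})=\lambda(s)$, $\omega^\ddagger(e_s)=\sum_{i\ne s}\lambda(i)$ and $\lambda^\ddagger(1')=\sum_{s}\lambda(s)$. **Theorem.** Let $\mathsf P$ be any network coding problem and let $(\lambda,\omega)\in\chi(\mathsf P)$. 1. If $T^\ddagger(\lambda,\omega)$ satisfies the secure outer bound for $\mathsf P^\ddagger$, then $(\lambda,\omega)$ lies in Yeung's outer bound for $\mathsf P$. 2. If $(\lambda,\omega)$ is zero-error achievable for $\mathsf P$, then $T^\ddagger(\lambda,\omega)$ is zero-error achievable for $\mathsf P^\ddagger$ under strong secrecy. -/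

import Mathlib

open Filter Topology

noncomputable section

/-! # Networks and network coding problems -/

/-- A directed acyclic hypergraph with nodes `V` and hyperedges `E`: the hyperedge `e` carries
messages without error from the node `tail e` to all the nodes of `head e`. -/
structure Network (V E : Type*) where
  tail : E → V
  head : E → Set V
  /-- No nonempty sequence of hyperedges is a directed cycle. -/
  acyclic : ∀ e : E, ¬ Relation.TransGen (fun f g : E => tail g ∈ head f) e e

/-- A network coding problem: a network with sources indexed by `S`, where the source `s` is
available at the nodes `O s` and has to be reconstructed at the nodes `D s`. -/
structure NetworkProblem (V E S : Type*) extends Network V E where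
  O : S → Set V
  D : S → Set V

/-- A secure network coding problem: the adversary `r` observes the messages on the hyperedges
in `B r` and aims to reconstruct the sources in `A r`. -/
structure SecureProblem (V E S R : Type*) extends NetworkProblem V E S where
  A : R → Set S
  B : R → Set E

namespace NetworkProblem

variable {V E S : Type*}

/-- The head of a source edge or of a hyperedge; sources are seen as imaginary edges into the
nodes at which they are available. -/
def headOf (P : NetworkProblem V E S) : S ⊕ E → Set V :=
  Sum.elim P.O P.head

/-- The sources and hyperedges that enter the node `u`. -/
def inNode (P : NetworkProblem V E S) (u : V) : Set (S ⊕ E) :=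
  {f | u ∈ P.headOf f}

/-- The sources and hyperedges that enter the transmit node of the hyperedge `e`. -/
def inEdge (P : NetworkProblem V E S) (e : E) : Set (S ⊕ E) :=
  {f | P.tail e ∈ P.headOf f}

end NetworkProblem

/-! # Random variables and entropy functions -/

/-- A family, indexed by `N`, of random variables with finitely many values on a common
probability space. Only the joint law matters, so the sample space is taken to be finite. -/
structure RandomVars (N : Type*) where
  Ω : Type
  [fintypeΩ : Fintype Ω]
  prob : PMF Ω
  alphabet : N → Type
  Y : (i : N) → Ω → alphabet i

namespace RandomVars

variable {N : Type*}

/-- The joint random variable `(Y i, i ∈ α)`. -/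
def joint (X : RandomVars N) (α : Set N) : X.Ω → ((i : α) → X.alphabet i) :=
  fun ω i => X.Y i ω

/-- The joint Shannon entropy `H(Y i, i ∈ α)` (in nats), as a function of `α`. The sum has only
finitely many nonzero terms, since the sample space is finite. -/
def entropy (X : RandomVars N) (α : Set N) : ℝ :=
  ∑ᶠ x : ((i : α) → X.alphabet i), Real.negMulLog ((X.prob.map (X.joint α)) x).toReal

/-- The support of `Y i`. -/
def supp (X : RandomVars N) (i : N) : Set (X.alphabet i) :=
  (X.prob.map (X.Y i)).support

/-- `log |SP(Y i)|` (in nats), where `SP` is the support. -/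
def logSupp (X : RandomVars N) (i : N) : ℝ :=
  Real.log ((X.supp i).ncard : ℝ)

/-- `Y i` is uniformly distributed over its support. -/
def IsUniform (X : RandomVars N) (i : N) : Prop :=
  ∀ x ∈ X.supp i, ∀ y ∈ X.supp i, X.prob.map (X.Y i) x = X.prob.map (X.Y i) y

end RandomVars

/-- Rank functions on `N`. -/
abbrev RankFunction (N : Type*) := Set N → ℝ

namespace RankFunction

variable {N : Type*}

/-- `g(α | β)` -/
def cond (g : RankFunction N) (α β : Set N) : ℝ := g (α ∪ β) - g β

/-- `g(α ∧ β)`, the mutual information when `g` is an entropy function. -/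
def mutualInfo (g : RankFunction N) (α β : Set N) : ℝ := g α + g β - g (α ∪ β)

end RankFunction

/-- `Γ*`, the set of entropic functions. -/
def entropic (N : Type*) : Set (RankFunction N) :=
  {h | ∃ X : RandomVars N, h = X.entropy}

/-- The set of weakly entropic functions: a positive multiple is entropic. -/
def weaklyEntropic (N : Type*) : Set (RankFunction N) :=
  {h | ∃ c : ℝ, 0 < c ∧ c • h ∈ entropic N}

/-- The set of almost entropic functions: limits of sequences of weakly entropic functions. -/
def almostEntropic (N : Type*) : Set (RankFunction N) :=
  {h | ∃ k : ℕ → RankFunction N, (∀ n, k n ∈ weaklyEntropic N) ∧ Tendsto k atTop (𝓝 h)}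

/-! # Rate-capacity tuples -/

/-- Source rates and hyperedge capacities. -/
structure RateCapacity (S E : Type*) where
  rate : S → ℝ
  cap : E → ℝ

/-- The set `χ` of (nonnegative) rate-capacity tuples. -/
def rateCapacityTuples (S E : Type*) : Set (RateCapacity S E) :=
  {t | (∀ s, 0 ≤ t.rate s) ∧ (∀ e, 0 ≤ t.cap e)}

/-- `CL(R)`: the tuples whose rates are at most, and whose capacities are at least, the limits of
positive multiples of a sequence of tuples in `R`. -/
def CL {S E : Type*} (R : Set (RateCapacity S E)) : Set (RateCapacity S E) :=
  {t | t ∈ rateCapacityTuples S E ∧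
    ∃ (r : ℕ → RateCapacity S E) (c : ℕ → ℝ), (∀ n, r n ∈ R) ∧ (∀ n, 0 < c n) ∧
      (∀ e, ∃ l, Tendsto (fun n => c n * (r n).cap e) atTop (𝓝 l) ∧ l ≤ t.cap e) ∧
      (∀ s, ∃ l, Tendsto (fun n => c n * (r n).rate s) atTop (𝓝 l) ∧ t.rate s ≤ l)}

/-! # Ordinary network coding: outer bound and zero-error achievability -/

namespace NetworkProblem

variable {V E S : Type*} (P : NetworkProblem V E S)

/-- The sources are independent. -/
def CI [Fintype S] (_ : NetworkProblem V E S) : Set (RankFunction (S ⊕ E)) :=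
  {h | h (Set.range Sum.inl) = ∑ s, h {Sum.inl s}}

/-- The message on a hyperedge is a function of what enters its transmit node. -/
def CT : Set (RankFunction (S ⊕ E)) :=
  {h | ∀ e, h.cond {Sum.inr e} (P.inEdge e) = 0}

/-- Each sink can decode the sources that it demands. -/
def CD : Set (RankFunction (S ⊕ E)) :=
  {h | ∀ s, ∀ u ∈ P.D s, h.cond {Sum.inl s} (P.inNode u) = 0}

/-- The coordinate projection of a rank function to its rate-capacity tuple. -/
def proj (_ : NetworkProblem V E S) (h : RankFunction (S ⊕ E)) : RateCapacity S E where
  rate s := h {Sum.inl s}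
  cap e := h {Sum.inr e}

/-- Yeung's outer bound. -/
def yeungOuterBound [Fintype S] : Set (RateCapacity S E) :=
  CL (P.proj '' (almostEntropic (S ⊕ E) ∩ P.CI ∩ P.CT ∩ P.CD))

/-- `X` is the family of random variables induced by a network code: the sources are mutually
independent and each is uniform on its support, and for each hyperedge `e` there is a local
encoding function `φ` that gives the message on `e` from the messages that enter its transmit
node. -/
def IsNetworkCode [Fintype S] (X : RandomVars (S ⊕ E)) : Prop :=
  (∀ s, X.IsUniform (Sum.inl s)) ∧
  (∀ y : (s : S) → X.alphabet (Sum.inl s),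
    X.prob.map (fun ω (s : S) => X.Y (Sum.inl s) ω) y =
      ∏ s, X.prob.map (X.Y (Sum.inl s)) (y s)) ∧
  (∀ e, ∃ φ : ((f : P.inEdge e) → X.alphabet f) → X.alphabet (Sum.inr e),
    ∀ ω ∈ X.prob.support, X.Y (Sum.inr e) ω = φ (X.joint (P.inEdge e) ω))

/-- The tuple `t` is zero-error achievable. -/
def ZeroErrorAchievable [Fintype S] (t : RateCapacity S E) : Prop :=
  ∃ (X : ℕ → RandomVars (S ⊕ E)) (c : ℕ → ℝ),
    (∀ n, P.IsNetworkCode (X n)) ∧ (∀ n, 0 < c n) ∧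
    (∀ s, ∃ l, Tendsto (fun n => c n * (X n).logSupp (Sum.inl s)) atTop (𝓝 l) ∧ t.rate s ≤ l) ∧
    (∀ e, ∃ l, Tendsto (fun n => c n * (X n).logSupp (Sum.inr e)) atTop (𝓝 l) ∧ l ≤ t.cap e) ∧
    (∀ n, ∀ s, ∀ u ∈ P.D s,
      RankFunction.cond (X n).entropy {Sum.inl s} (P.inNode u) = 0)

end NetworkProblem

/-! # Secure network coding: outer bound and zero-error achievability with strong secrecy

The rank functions are indexed by `(S ⊕ E) ⊕ V`, that is by sources, hyperedges and nodes; the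
coordinate of a node belongs to the random key that the node generates. -/

namespace SecureProblem

variable {V E S R : Type*} (P : SecureProblem V E S R)

/-- The sources and the local random keys are independent. -/
def CI [Fintype S] [Fintype V] (_ : SecureProblem V E S R) :
    Set (RankFunction ((S ⊕ E) ⊕ V)) :=
  {h | h (Set.range (fun s => Sum.inl (Sum.inl s)) ∪ Set.range Sum.inr) =
    ∑ s, h {Sum.inl (Sum.inl s)} + ∑ u, h {Sum.inr u}}

/-- The message on a hyperedge is a function of what enters its transmit node and of the random
key of that node. -/
def CT : Set (RankFunction ((S ⊕ E) ⊕ V)) :=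
  {h | ∀ e, h.cond {Sum.inl (Sum.inr e)} (Sum.inl '' P.inEdge e ∪ {Sum.inr (P.tail e)}) = 0}

/-- Each sink can decode the sources that it demands. -/
def CD : Set (RankFunction ((S ⊕ E) ⊕ V)) :=
  {h | ∀ s, ∀ u ∈ P.D s, h.cond {Sum.inl (Sum.inl s)} (Sum.inl '' P.inNode u) = 0}

/-- No adversary gains information on the sources that it aims at. -/
def CS : Set (RankFunction ((S ⊕ E) ⊕ V)) :=
  {h | ∀ r, h.mutualInfo ((fun s => Sum.inl (Sum.inl s)) '' P.A r)
    ((fun e => Sum.inl (Sum.inr e)) '' P.B r) = 0}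

/-- The coordinate projection of a rank function to its rate-capacity tuple. -/
def proj (_ : SecureProblem V E S R) (h : RankFunction ((S ⊕ E) ⊕ V)) : RateCapacity S E where
  rate s := h {Sum.inl (Sum.inl s)}
  cap e := h {Sum.inl (Sum.inr e)}

/-- The tuple `t` satisfies the outer bound for the secure network coding problem. -/
def SatisfiesOuterBound [Fintype S] [Fintype V] (t : RateCapacity S E) : Prop :=
  ∃ h ∈ almostEntropic ((S ⊕ E) ⊕ V) ∩ P.CI ∩ P.CT ∩ P.CD ∩ P.CS, t ∈ CL {P.proj h}

/-- `X` is a stochastic network code. -/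
def IsStochasticCode [Fintype S] [Fintype V] (X : RandomVars ((S ⊕ E) ⊕ V)) : Prop :=
  (∀ s, X.IsUniform (Sum.inl (Sum.inl s))) ∧ X.entropy ∈ P.CI ∩ P.CT

/-- The tuple `t` is zero-error achievable subject to the strong secrecy constraint. -/
def StronglySecureAchievable [Fintype S] [Fintype V] (t : RateCapacity S E) : Prop :=
  ∃ (X : ℕ → RandomVars ((S ⊕ E) ⊕ V)) (c : ℕ → ℝ),
    (∀ n, P.IsStochasticCode (X n)) ∧ (∀ n, 0 < c n) ∧
    (∀ e, ∃ l, Tendsto (fun n => c n * (X n).logSupp (Sum.inl (Sum.inr e))) atTop (𝓝 l) ∧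
      l ≤ t.cap e) ∧
    (∀ s, ∃ l, Tendsto (fun n => c n * (X n).logSupp (Sum.inl (Sum.inl s))) atTop (𝓝 l) ∧
      t.rate s ≤ l) ∧
    (∀ n, ∀ s, ∀ u ∈ P.D s,
      RankFunction.cond (X n).entropy {Sum.inl (Sum.inl s)} (Sum.inl '' P.inNode u) = 0) ∧
    (∀ n, ∀ r, RankFunction.mutualInfo (X n).entropy ((fun s => Sum.inl (Sum.inl s)) '' P.A r)
      ((fun e => Sum.inl (Sum.inr e)) '' P.B r) = 0)

end SecureProblem

/-! # The single-source secure problem built from an ordinary problem -/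

namespace NetworkProblem

variable {V E S : Type*}

/-- The pairs `(s, u)` of a source `s` and a sink node `u ∈ D s`. -/
abbrev Demand (P : NetworkProblem V E S) := {q : S × V // q.2 ∈ P.D q.1}

/-- The nodes of the secure problem. -/
inductive SecNode (P : NetworkProblem V E S)
  | old (v : V)
  | psi (s : S)
  | gamma (s : S)
  | theta (q : P.Demand)
  | tau (q : P.Demand)
  | phi
  | eta

/-- The hyperedges of the secure problem. -/
inductive SecEdge (P : NetworkProblem V E S)
  | old (e : E)
  | a (s : S)
  | b (s : S)
  | c (s : S)
  | e (s : S)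
  | d (q : P.Demand)
  | w (q : P.Demand)

instance (P : NetworkProblem V E S) [Finite V] [Finite S] : Finite P.SecNode :=
  Finite.of_injective
    (fun x : P.SecNode => (match x with
      | .old v => .inl v
      | .psi s => .inr (.inl s)
      | .gamma s => .inr (.inr (.inl s))
      | .theta q => .inr (.inr (.inr (.inl q)))
      | .tau q => .inr (.inr (.inr (.inr (.inl q))))
      | .phi => .inr (.inr (.inr (.inr (.inr true))))
      | .eta => .inr (.inr (.inr (.inr (.inr false)))) :
        V ⊕ S ⊕ S ⊕ P.Demand ⊕ P.Demand ⊕ Bool))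
    (by intro x y h; cases x <;> cases y <;> simp_all)

instance (P : NetworkProblem V E S) [Fintype V] [Fintype S] : Fintype P.SecNode :=
  Fintype.ofFinite _

/-- The transmit nodes in the secure problem. -/
def secTail (P : NetworkProblem V E S) : P.SecEdge → P.SecNode
  | .old e => .old (P.tail e)
  | .a _ => .phi
  | .b _ => .phi
  | .c s => .gamma s
  | .e _ => .phi
  | .d q => .old q.1.2
  | .w q => .theta q

/-- The receiving nodes in the secure problem. -/
def secHead (P : NetworkProblem V E S) : P.SecEdge → Set P.SecNode
  | .old e => SecNode.old '' P.head e
  | .a s => SecNode.old '' P.O s ∪ {.eta} ∪ {.gamma s}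
  | .b s => {.gamma s, .eta} ∪ SecNode.theta '' {q | q.1.1 = s}
  | .c s => {.psi s}
  | .e s => {.psi s} ∪ SecNode.tau '' {q | q.1.1 = s}
  | .d q => {.theta q}
  | .w q => {.tau q}

/-- An auxiliary level function that shows that the network of the secure problem is acyclic. -/
def secLevel (P : NetworkProblem V E S) : P.SecEdge → ℕ
  | .old _ => 1
  | .a _ => 0
  | .b _ => 0
  | .c _ => 2
  | .e _ => 0
  | .d _ => 2
  | .w _ => 3

theorem secStep (P : NetworkProblem V E S) (x y : P.SecEdge) (h : P.secTail y ∈ P.secHead x) :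
    P.secLevel x < P.secLevel y ∨
      ∃ e f : E, x = .old e ∧ y = .old f ∧ P.tail f ∈ P.head e := by
  cases x <;> cases y <;> simp_all [secTail, secHead, secLevel]

theorem secAcyclic (P : NetworkProblem V E S) (x : P.SecEdge) :
    ¬ Relation.TransGen (fun f g : P.SecEdge => P.secTail g ∈ P.secHead f) x x := by
  have key : ∀ y, Relation.TransGen (fun f g : P.SecEdge => P.secTail g ∈ P.secHead f) x y →
      P.secLevel x < P.secLevel y ∨ ∃ e f : E, x = .old e ∧ y = .old f ∧
        Relation.TransGen (fun f g : E => P.tail g ∈ P.head f) e f := by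
    intro y h
    induction h with
    | single h =>
      rcases P.secStep _ _ h with h | ⟨e, f, rfl, rfl, h'⟩
      · exact Or.inl h
      · exact Or.inr ⟨e, f, rfl, rfl, .single h'⟩
    | tail _ h ih =>
      rcases P.secStep _ _ h with h | ⟨e, f, rfl, rfl, h'⟩
      · rcases ih with ih | ⟨e, f, rfl, rfl, ih⟩
        · exact Or.inl (ih.trans h)
        · exact Or.inl h
      · rcases ih with ih | ⟨e', f', rfl, hf, ih⟩
        · exact Or.inl ih
        · cases hf
          exact Or.inr ⟨e', f, rfl, rfl, ih.tail h'⟩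
  intro h
  rcases key x h with h | ⟨e, f, rfl, hf, h⟩
  · exact lt_irrefl _ h
  · cases hf
    exact P.acyclic _ h

/-- The secure problem built from `P`. It has a single source (the element of `Unit`), available
at the node `phi` only, and two wiretappers; both aim at that source, the first observes all the
hyperedges `a s` and the second all the hyperedges `b s`. -/
def toSecure (P : NetworkProblem V E S) : SecureProblem P.SecNode P.SecEdge Unit (Fin 2) where
  tail := P.secTail
  head := P.secHead
  acyclic := P.secAcyclic
  O := fun _ => {.phi}
  D := fun _ => Set.range SecNode.tau ∪ Set.range SecNode.psi ∪ {.eta}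
  A := fun _ => Set.univ
  B := ![Set.range SecEdge.a, Set.range SecEdge.b]

open Classical in
/-- The tuple for the secure problem that is induced by a tuple for `P`. -/
def toSecureTuple [Fintype S] (P : NetworkProblem V E S) (t : RateCapacity S E) :
    RateCapacity Unit P.SecEdge where
  rate := fun _ => ∑ s, t.rate s
  cap
    | .old e => t.cap e
    | .a s => t.rate s
    | .b s => t.rate s
    | .c s => t.rate s
    | .e s => ∑ i ∈ Finset.univ.erase s, t.rate i
    | .d q => t.rate q.1.1
    | .w q => t.rate q.1.1

end NetworkProblem

end

/-! Write M for the message, A and B for the families of all `a s` and all `b s`, and λ for the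
rates of `P`.

Outer bound. M is independent of A and of B, while `eta` recovers it from (A, B). Hence H(M) + H(A)
≤ H(A, B) ≤ H(A) + H(B), and likewise with A and B exchanged. The capacities allow A and B at most ∑
λ each, and M needs at least that much, so everything is an equality (`tight`): the `a s` are
independent of entropy λ(s), and A is independent of B. Decoding at `psi s` and `tau q` is equally
tight, so `c s` and `w q` are functions of M of entropy λ(s). Local keys cannot affect functions of
M, so `c s` is a function of `a s` and `b s`; being independent of `b s` and large enough, it acts
as a one-time pad and can be inverted (`det_a`). The same inversion applied to `w q` shows that `c
s` is a function of `w q` (`det_c_w`). Thus `a s` is determined by `b s`, `d q` and new keys; as `a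
s` and `d q` are independent of B and the new keys, `d q` alone determines `a s` (`det_a_d`). The
node u therefore decodes `a s`, up to the keys of the old nodes. Conditioning on those keys, with
the `a s` as sources, gives a point of the region for `P`. Conditioning preserves almost entropic
functions because the chain rule makes it an average of entropic ones, and almost entropic functions
form a closed convex cone (`contract_mem_almostEntropic`).

Achievability. Let `phi` draw a uniform pad K and run the code of `P` on K instead of on the
message: `a s` carries K_s, `b s` carries M_s + K_s, and a sink recovers K_s, hence M_s. The pad
must have rate exactly λ(s), so source alphabets are first cut down to cyclic groups of the right
size (`exists_blockCodes`). -/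

set_option linter.unusedSectionVars false

noncomputable section

/-! # Entropy of a partition of a finite weighted space -/

namespace SetoidEntropy

variable {Ω Ω' : Type*} [Fintype Ω] [Fintype Ω']

open Classical in
/-- The weight of the class of `ω`. -/
def mass (p : Ω → ℝ) (r : Setoid Ω) (ω : Ω) : ℝ := ∑ ω', if r ω ω' then p ω' else 0

/-- The entropy of the partition into the classes of `r`. -/
def ent (p : Ω → ℝ) (r : Setoid Ω) : ℝ := -∑ ω, p ω * Real.log (mass p r ω)

variable {p : Ω → ℝ} {r r' : Setoid Ω}

theorem mass_nonneg (hp : ∀ ω, 0 ≤ p ω) (ω : Ω) : 0 ≤ mass p r ω := by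
  classical
  exact Finset.sum_nonneg fun x _ => by split_ifs <;> simp [hp]

theorem le_mass (hp : ∀ ω, 0 ≤ p ω) {ω ω' : Ω} (h : r ω ω') : p ω' ≤ mass p r ω := by
  classical
  have := Finset.single_le_sum (f := fun x => if r ω x then p x else 0)
    (fun x _ => by split_ifs <;> simp [hp]) (Finset.mem_univ ω')
  simpa [h, mass] using this

theorem mass_pos (hp : ∀ ω, 0 ≤ p ω) {ω : Ω} (h : 0 < p ω) : 0 < mass p r ω :=
  h.trans_le (le_mass hp (r.refl ω))

theorem mass_congr {ω ω' : Ω} (h : r ω ω') : mass p r ω = mass p r ω' := by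
  classical
  refine Finset.sum_congr rfl fun x _ => ?_
  have : r ω x ↔ r ω' x := ⟨fun h' => r.trans (r.symm h) h', fun h' => r.trans h h'⟩
  simp [this]

theorem mass_mono (hp : ∀ ω, 0 ≤ p ω) (h : r ≤ r') (ω : Ω) : mass p r ω ≤ mass p r' ω := by
  classical
  refine Finset.sum_le_sum fun x _ => ?_
  by_cases hx : r ω x
  · simp [hx, show r' ω x from h hx]
  · simp only [hx, if_false]
    split_ifs <;> simp [hp]

theorem mass_eq_iff (hp : ∀ ω, 0 ≤ p ω) (h : r ≤ r') (ω : Ω) :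
    mass p r ω = mass p r' ω ↔ ∀ ω', 0 < p ω' → r' ω ω' → r ω ω' := by
  classical
  unfold mass
  rw [Finset.sum_eq_sum_iff_of_le]
  · constructor
    · intro H x hx hr
      have := H x (Finset.mem_univ x)
      by_contra hc
      simp [hr, hc] at this
      exact hx.ne this
    · intro H x _
      by_cases hx : r ω x
      · simp [hx, show r' ω x from h hx]
      · simp only [hx, if_false]
        split_ifs with h1
        · rcases (hp x).eq_or_lt with h2 | h2
          · exact h2
          · exact absurd (H x h2 h1) hx
        · rfl
  · intro x _
    by_cases hx : r ω x
    · simp [hx, show r' ω x from h hx]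
    · simp only [hx, if_false]
      split_ifs <;> simp [hp]

theorem ent_top (hs : ∑ ω, p ω = 1) : ent p ⊤ = 0 := by
  classical
  have : ∀ ω, mass p ⊤ ω = 1 := fun ω => by
    rw [← hs]; exact Finset.sum_congr rfl fun x _ => by simp
  simp [ent, this]

theorem ent_sub_ent (p : Ω → ℝ) (r r' : Setoid Ω) : ent p r - ent p r' =
    ∑ ω, p ω * (Real.log (mass p r' ω) - Real.log (mass p r ω)) := by
  simp only [ent, mul_sub, Finset.sum_sub_distrib]; ring

theorem ent_term_nonneg (hp : ∀ ω, 0 ≤ p ω) (h : r ≤ r') (ω : Ω) :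
    0 ≤ p ω * (Real.log (mass p r' ω) - Real.log (mass p r ω)) := by
  rcases (hp ω).eq_or_lt with h2 | h2
  · simp [← h2]
  · exact mul_nonneg h2.le (sub_nonneg.2 (Real.log_le_log (mass_pos hp h2) (mass_mono hp h ω)))

theorem ent_anti (hp : ∀ ω, 0 ≤ p ω) (h : r ≤ r') : ent p r' ≤ ent p r := by
  rw [← sub_nonneg, ent_sub_ent]
  exact Finset.sum_nonneg fun ω _ => ent_term_nonneg hp h ω

/-- The difference of the entropies is a sum of nonnegative terms, so it vanishes only if each term
does, and then classes of positive outcomes have equal mass. Outcomes of weight zero play no role.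
-/
theorem ent_eq_iff (hp : ∀ ω, 0 ≤ p ω) (h : r ≤ r') :
    ent p r = ent p r' ↔ ∀ ω ω', 0 < p ω → 0 < p ω' → r' ω ω' → r ω ω' := by
  rw [← sub_eq_zero, ent_sub_ent,
    Finset.sum_eq_zero_iff_of_nonneg fun ω _ => ent_term_nonneg hp h ω]
  have key : ∀ ω, 0 < p ω → (p ω * (Real.log (mass p r' ω) - Real.log (mass p r ω)) = 0 ↔
      mass p r ω = mass p r' ω) := by
    intro ω hω
    rw [mul_eq_zero, or_iff_right hω.ne', sub_eq_zero]
    constructor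
    · intro h1
      exact (Real.log_injOn_pos (mass_pos hp hω) (mass_pos hp hω) h1).symm
    · intro h1; rw [h1]
  constructor
  · intro H ω ω' hω hω' hr
    exact (mass_eq_iff hp h ω).1 ((key ω hω).1 (H ω (Finset.mem_univ ω))) ω' hω' hr
  · intro H ω _
    rcases (hp ω).eq_or_lt with h2 | h2
    · simp [← h2]
    · exact (key ω h2).2 ((mass_eq_iff hp h ω).2 fun ω' hω' => H ω ω' h2 hω')

/-- The estimate behind submodularity. Expand the two masses in the numerator as sums over x and y
and sum over `ω` first: the `ω` related to x by `r₁` and to y by `r₂` are empty or one class of `r₁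
⊓ r₂`, whose mass cancels the first denominator. Only 1 / `mass p r₃ x` remains, and it sums to 1
over the class of x. -/
theorem sum_div_mass_le (hp : ∀ ω, 0 ≤ p ω) (hs : ∑ ω, p ω = 1) {r₁ r₂ r₃ : Setoid Ω}
    (h₁ : r₁ ≤ r₃) (h₂ : r₂ ≤ r₃) :
    ∑ ω, p ω * (mass p r₁ ω * mass p r₂ ω / (mass p (r₁ ⊓ r₂) ω * mass p r₃ ω)) ≤ 1 := by
  classical
  have e1 : ∀ ω, p ω * (mass p r₁ ω * mass p r₂ ω / (mass p (r₁ ⊓ r₂) ω * mass p r₃ ω)) =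
      ∑ x, ∑ y, p x * p y * (if r₁ ω x ∧ r₂ ω y then
        p ω / (mass p (r₁ ⊓ r₂) ω * mass p r₃ ω) else 0) := by
    intro ω
    have : mass p r₁ ω * mass p r₂ ω = ∑ x, ∑ y, (if r₁ ω x ∧ r₂ ω y then p x * p y else 0) := by
      unfold mass
      rw [Finset.sum_mul_sum]
      refine Finset.sum_congr rfl fun x _ => Finset.sum_congr rfl fun y _ => ?_
      by_cases hx : r₁ ω x <;> by_cases hy : r₂ ω y <;> simp [hx, hy]
    rw [this, mul_div_assoc', mul_comm (p ω), ← mul_div_assoc', Finset.sum_mul]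
    refine Finset.sum_congr rfl fun x _ => ?_
    rw [Finset.sum_mul]
    refine Finset.sum_congr rfl fun y _ => ?_
    split_ifs <;> simp
  have e2 : ∀ x y, 0 < p x → ∑ ω, (if r₁ ω x ∧ r₂ ω y then
      p ω / (mass p (r₁ ⊓ r₂) ω * mass p r₃ ω) else 0) ≤
      if r₃ x y then (mass p r₃ x)⁻¹ else 0 := by
    intro x y hx
    by_cases hE : ∃ ω, 0 < p ω ∧ r₁ ω x ∧ r₂ ω y
    · obtain ⟨ω₀, hp0, hx0, hy0⟩ := hE
      have h3 : r₃ x y := r₃.trans (r₃.symm (h₁ hx0)) (h₂ hy0)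
      rw [if_pos h3]
      have : ∀ ω, (if r₁ ω x ∧ r₂ ω y then
          p ω / (mass p (r₁ ⊓ r₂) ω * mass p r₃ ω) else 0) =
          (if (r₁ ⊓ r₂) ω₀ ω then p ω else 0) * ((mass p (r₁ ⊓ r₂) ω₀)⁻¹ * (mass p r₃ x)⁻¹) := by
        intro ω
        have hiff : (r₁ ω x ∧ r₂ ω y) ↔ (r₁ ⊓ r₂) ω₀ ω :=
          ⟨fun h => ⟨r₁.trans hx0 (r₁.symm h.1), r₂.trans hy0 (r₂.symm h.2)⟩,
            fun h => ⟨r₁.trans (r₁.symm h.1) hx0, r₂.trans (r₂.symm h.2) hy0⟩⟩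
        by_cases hc : (r₁ ⊓ r₂) ω₀ ω
        · rw [if_pos (hiff.2 hc), if_pos hc, mass_congr hc, mass_congr (h₁ (hiff.2 hc).1),
            div_eq_mul_inv, mul_inv]
        · rw [if_neg (fun h => hc (hiff.1 h)), if_neg hc, zero_mul]
      rw [Finset.sum_congr rfl fun ω _ => this ω, ← Finset.sum_mul]
      change mass p (r₁ ⊓ r₂) ω₀ * _ ≤ _
      rw [mul_inv_cancel_left₀ (mass_pos hp hp0).ne']
    · have : ∀ ω, (if r₁ ω x ∧ r₂ ω y then
          p ω / (mass p (r₁ ⊓ r₂) ω * mass p r₃ ω) else 0) = 0 := by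
        intro ω
        split_ifs with h
        · rcases (hp ω).eq_or_lt with h2 | h2
          · simp [← h2]
          · exact absurd ⟨ω, h2, h⟩ hE
        · rfl
      rw [Finset.sum_congr rfl fun ω _ => this ω]
      simp only [Finset.sum_const_zero]
      split_ifs
      · exact inv_nonneg.2 (mass_nonneg hp x)
      · rfl
  rw [Finset.sum_congr rfl fun ω _ => e1 ω, Finset.sum_comm]
  calc ∑ x, ∑ ω, ∑ y, p x * p y * (if r₁ ω x ∧ r₂ ω y then
        p ω / (mass p (r₁ ⊓ r₂) ω * mass p r₃ ω) else 0)
      = ∑ x, p x * ∑ y, p y * ∑ ω, (if r₁ ω x ∧ r₂ ω y then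
        p ω / (mass p (r₁ ⊓ r₂) ω * mass p r₃ ω) else 0) := by
        refine Finset.sum_congr rfl fun x _ => ?_
        rw [Finset.sum_comm, Finset.mul_sum]
        refine Finset.sum_congr rfl fun y _ => ?_
        rw [Finset.mul_sum, Finset.mul_sum]
        exact Finset.sum_congr rfl fun ω _ => by ring
    _ ≤ ∑ x, p x := by
        refine Finset.sum_le_sum fun x _ => ?_
        rcases (hp x).eq_or_lt with h2 | h2
        · simp [← h2]
        refine mul_le_of_le_one_right h2.le ?_
        calc _ ≤ ∑ y, p y * (if r₃ x y then (mass p r₃ x)⁻¹ else 0) :=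
              Finset.sum_le_sum fun y _ => mul_le_mul_of_nonneg_left (e2 x y h2) (hp y)
          _ = mass p r₃ x * (mass p r₃ x)⁻¹ := by
              rw [mass, Finset.sum_mul]
              exact Finset.sum_congr rfl fun y _ => by split_ifs <;> simp
          _ = 1 := mul_inv_cancel₀ (mass_pos hp h2).ne'
    _ = 1 := hs

/-- Average the inequality log t ≥ 1 - 1/t, with 1/t the ratio bounded in `sum_div_mass_le`. It
suffices that `r₃` be coarser than both partitions; it need not be their join. -/
theorem ent_submodular (hp : ∀ ω, 0 ≤ p ω) (hs : ∑ ω, p ω = 1) {r₁ r₂ r₃ : Setoid Ω}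
    (h₁ : r₁ ≤ r₃) (h₂ : r₂ ≤ r₃) : ent p (r₁ ⊓ r₂) + ent p r₃ ≤ ent p r₁ + ent p r₂ := by
  have key : ∀ ω, p ω * (1 - mass p r₁ ω * mass p r₂ ω / (mass p (r₁ ⊓ r₂) ω * mass p r₃ ω)) ≤
      p ω * (Real.log (mass p (r₁ ⊓ r₂) ω) + Real.log (mass p r₃ ω) - Real.log (mass p r₁ ω)
        - Real.log (mass p r₂ ω)) := by
    intro ω
    rcases (hp ω).eq_or_lt with h2 | h2
    · simp [← h2]
    have m : ∀ r : Setoid Ω, 0 < mass p r ω := fun r => mass_pos hp h2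
    refine mul_le_mul_of_nonneg_left ?_ h2.le
    have := Real.one_sub_inv_le_log_of_pos
      (x := mass p (r₁ ⊓ r₂) ω * mass p r₃ ω / (mass p r₁ ω * mass p r₂ ω))
      (div_pos (mul_pos (m _) (m _)) (mul_pos (m _) (m _)))
    rw [inv_div, Real.log_div (mul_pos (m _) (m _)).ne' (mul_pos (m _) (m _)).ne',
      Real.log_mul (m _).ne' (m _).ne', Real.log_mul (m _).ne' (m _).ne'] at this
    linarith
  have h3 := Finset.sum_le_sum fun ω (_ : ω ∈ Finset.univ) => key ω
  have h4 := sum_div_mass_le hp hs h₁ h₂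
  simp only [mul_sub, mul_add, Finset.sum_sub_distrib, Finset.sum_add_distrib, mul_one] at h3
  simp only [ent]
  linarith

/-- Weights conditioned on the class of `ω`. -/
def condWeight (p : Ω → ℝ) (b : Setoid Ω) (ω ω' : Ω) : ℝ :=
  open Classical in if b ω ω' then p ω' / mass p b ω else 0

theorem condWeight_nonneg (hp : ∀ ω, 0 ≤ p ω) (b : Setoid Ω) (ω ω' : Ω) :
    0 ≤ condWeight p b ω ω' := by
  unfold condWeight
  split_ifs
  · exact div_nonneg (hp _) (mass_nonneg hp _)
  · rfl

theorem sum_condWeight (hp : ∀ ω, 0 ≤ p ω) (b : Setoid Ω) {ω : Ω} (h : 0 < p ω) :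
    ∑ ω', condWeight p b ω ω' = 1 := by
  classical
  have : ∀ ω', condWeight p b ω ω' = (if b ω ω' then p ω' else 0) * (mass p b ω)⁻¹ := by
    intro ω'; unfold condWeight; split_ifs <;> simp [div_eq_mul_inv]
  rw [Finset.sum_congr rfl fun ω' _ => this ω', ← Finset.sum_mul]
  exact mul_inv_cancel₀ (mass_pos hp h).ne'

/-- The chain rule, with the conditional entropy written as an average of entropies under
conditioned laws; this form is what makes conditioning preserve almost entropic functions. -/
theorem ent_inf_sub (hp : ∀ ω, 0 ≤ p ω) (r b : Setoid Ω) :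
    ent p (r ⊓ b) - ent p b = ∑ ω, p ω * ent (condWeight p b ω) r := by
  classical
  have h1 : ∀ ω ω', b ω ω' →
      mass (condWeight p b ω) r ω' = mass p (r ⊓ b) ω' / mass p b ω' := by
    intro ω ω' h
    rw [div_eq_mul_inv, mass, mass, Finset.sum_mul]
    refine Finset.sum_congr rfl fun x _ => ?_
    have : b ω x ↔ b ω' x := ⟨fun h' => b.trans (b.symm h) h', fun h' => b.trans h h'⟩
    unfold condWeight
    rw [mass_congr h]
    have hi : (r ⊓ b) ω' x ↔ r ω' x ∧ b ω' x := Iff.rfl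
    by_cases hx : r ω' x <;> by_cases hy : b ω' x <;>
      simp [hx, hy, this, hi, div_eq_mul_inv]
  have h2 : ∀ ω, p ω * ent (condWeight p b ω) r = ∑ ω', (if b ω' ω then p ω else 0) *
      (p ω' / mass p b ω' * (Real.log (mass p b ω') - Real.log (mass p (r ⊓ b) ω'))) := by
    intro ω
    rw [ent, mul_neg, Finset.mul_sum, ← Finset.sum_neg_distrib]
    refine Finset.sum_congr rfl fun x _ => ?_
    by_cases hx : b ω x
    · rw [h1 ω x hx, condWeight, if_pos hx, if_pos (b.symm hx), mass_congr hx]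
      rcases (hp x).eq_or_lt with h2 | h2
      · simp [← h2]
      · rw [Real.log_div (mass_pos hp h2).ne' (mass_pos hp h2).ne']; ring
    · rw [condWeight, if_neg hx, if_neg (fun h => hx (b.symm h))]; simp
  -- After the exchange, the inner sum of `p ω` over the class of x is `mass p b x`, which cancels
  -- the normalization of the conditioned weights.
  rw [ent_sub_ent, Finset.sum_congr rfl fun ω _ => h2 ω, Finset.sum_comm]
  refine Finset.sum_congr rfl fun x _ => ?_
  rw [← Finset.sum_mul]
  change _ = mass p b x * _
  rcases (hp x).eq_or_lt with h2 | h2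
  · simp [← h2]
  · have := (mass_pos hp h2 (r := b)).ne'
    field_simp

theorem ent_prod {q : Ω' → ℝ} (hp : ∀ ω, 0 ≤ p ω) (hq : ∀ ω, 0 ≤ q ω) (hps : ∑ ω, p ω = 1)
    (hqs : ∑ ω, q ω = 1) (r : Setoid Ω) (s : Setoid Ω') :
    ent (fun x : Ω × Ω' => p x.1 * q x.2) (r.prod s) = ent p r + ent q s := by
  classical
  have h1 : ∀ x : Ω × Ω', mass (fun x : Ω × Ω' => p x.1 * q x.2) (r.prod s) x =
      mass p r x.1 * mass q s x.2 := by
    intro x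
    rw [mass, mass, mass, Finset.sum_mul_sum, Fintype.sum_prod_type]
    refine Finset.sum_congr rfl fun a _ => Finset.sum_congr rfl fun b _ => ?_
    have : (r.prod s) x (a, b) ↔ r x.1 a ∧ s x.2 b := Iff.rfl
    by_cases hx : r x.1 a <;> by_cases hy : s x.2 b <;> simp [hx, hy, this]
  have h2 : ∀ x : Ω × Ω', p x.1 * q x.2 * Real.log (mass p r x.1 * mass q s x.2) =
      (p x.1 * Real.log (mass p r x.1)) * q x.2 + p x.1 * (q x.2 * Real.log (mass q s x.2)) := by
    intro x
    rcases (hp x.1).eq_or_lt with h | h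
    · simp [← h]
    rcases (hq x.2).eq_or_lt with h' | h'
    · simp [← h']
    rw [Real.log_mul (mass_pos hp h).ne' (mass_pos hq h').ne']; ring
  simp only [ent]
  simp_rw [h1, h2]
  rw [Fintype.sum_prod_type]
  simp_rw [Finset.sum_add_distrib, ← Finset.mul_sum, ← Finset.sum_mul, hps, hqs]
  ring

theorem ent_comap_equiv (e : Ω' ≃ Ω) (p : Ω → ℝ) (r : Setoid Ω) :
    ent (fun x => p (e x)) (r.comap e) = ent p r := by
  classical
  have : ∀ x, mass (fun x => p (e x)) (r.comap e) x = mass p r (e x) := by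
    intro x
    exact Equiv.sum_comp e (fun y => if r (e x) y then p y else 0)
  simp only [ent, this]
  rw [Equiv.sum_comp e (fun y => p y * Real.log (mass p r y))]

/-- The entropy of a partition of a uniform space into classes of equal size. -/
theorem ent_uniform_hom {G T : Type*} [Fintype G] [AddCommGroup G] [AddCommGroup T] [Fintype T]
    (f : G →+ T) (hf : Function.Surjective f) :
    ent (fun _ : G => (Fintype.card G : ℝ)⁻¹) (Setoid.ker f) = Real.log (Fintype.card T) := by
  classical
  have hG : (0 : ℝ) < Fintype.card G := by exact_mod_cast Fintype.card_pos
  have hT : (0 : ℝ) < Fintype.card T := by exact_mod_cast Fintype.card_pos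
  have hcard : ∀ ω, ((Finset.univ.filter fun x => f ω = f x).card : ℝ) * Fintype.card T =
      Fintype.card G := by
    have h0 : ∀ ω ω', (Finset.univ.filter fun x => f ω = f x).card =
        (Finset.univ.filter fun x => f ω' = f x).card := by
      intro ω ω'
      -- Fibres of a homomorphism are translates of each other.
      refine Finset.card_bij' (fun x _ => x - ω + ω') (fun x _ => x - ω' + ω) ?_ ?_ ?_ ?_
      · intro x hx
        simp only [Finset.mem_filter, Finset.mem_univ, true_and, map_add, map_sub] at hx ⊢
        rw [hx]; simp
      · intro x hx
        simp only [Finset.mem_filter, Finset.mem_univ, true_and, map_add, map_sub] at hx ⊢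
        rw [hx]; simp
      · intro x _; simp
      · intro x _; simp
    intro ω
    have h1 : Fintype.card G = ∑ t : T, (Finset.univ.filter fun x => f x = t).card :=
      Finset.card_eq_sum_card_fiberwise (f := f) (s := Finset.univ) (t := Finset.univ)
        (fun _ _ => Finset.mem_coe.2 (Finset.mem_univ _))
    have h2 : ∀ t : T, (Finset.univ.filter fun x => f x = t).card =
        (Finset.univ.filter fun x => f ω = f x).card := by
      intro t
      obtain ⟨y, rfl⟩ := hf t
      rw [h0 ω y]
      congr 1; ext x; simp [eq_comm]
    rw [Finset.sum_congr rfl fun t _ => h2 t, Finset.sum_const, Finset.card_univ,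
      smul_eq_mul] at h1
    rw [h1]; push_cast; ring
  have hm : ∀ ω, mass (fun _ : G => (Fintype.card G : ℝ)⁻¹) (Setoid.ker f) ω =
      (Fintype.card T : ℝ)⁻¹ := by
    intro ω
    have : mass (fun _ : G => (Fintype.card G : ℝ)⁻¹) (Setoid.ker f) ω =
        ((Finset.univ.filter fun x => f ω = f x).card : ℝ) * (Fintype.card G : ℝ)⁻¹ := by
      rw [mass, ← Finset.sum_filter, Finset.sum_const, nsmul_eq_mul]
      congr 2
    rw [this, ← hcard ω, mul_inv]
    have : ((Finset.univ.filter fun x => f ω = f x).card : ℝ) ≠ 0 := by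
      intro h
      have := hcard ω
      rw [h, zero_mul] at this
      exact hG.ne this
    field_simp
  simp only [ent, hm, Finset.sum_const, Finset.card_univ, nsmul_eq_mul, Real.log_inv]
  field_simp

end SetoidEntropy

/-! # Entropy of families of random variables -/

theorem Setoid.biInf_apply {N Ω : Type*} (r : N → Setoid Ω) (α : Set N) (x y : Ω) :
    (⨅ i ∈ α, r i) x y ↔ ∀ i ∈ α, r i x y := by
  rw [← sInf_image, Setoid.sInf_def]
  simp

attribute [instance] RandomVars.fintypeΩ

namespace RandomVars

open SetoidEntropy

variable {N : Type*}

/-- The probabilities of the outcomes as real numbers. -/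
def weight (X : RandomVars N) (ω : X.Ω) : ℝ := (X.prob ω).toReal

/-- The outcomes that cannot be told apart by the variables in `α`. -/
def agree (X : RandomVars N) (α : Set N) : Setoid X.Ω := Setoid.ker (X.joint α)

theorem agree_iff (X : RandomVars N) {α : Set N} {ω ω' : X.Ω} :
    X.agree α ω ω' ↔ ∀ i ∈ α, X.Y i ω = X.Y i ω' := by
  change X.joint α ω = X.joint α ω' ↔ _
  exact ⟨fun h i hi => congrFun h ⟨i, hi⟩, fun h => funext fun i => h i i.2⟩

theorem agree_union (X : RandomVars N) (α β : Set N) :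
    X.agree (α ∪ β) = X.agree α ⊓ X.agree β := by
  ext ω ω'
  rw [Setoid.inf_iff_and]
  simp only [agree_iff, Set.mem_union]
  exact ⟨fun h => ⟨fun i hi => h i (.inl hi), fun i hi => h i (.inr hi)⟩,
    fun h i hi => hi.elim (h.1 i) (h.2 i)⟩

theorem agree_anti (X : RandomVars N) {α β : Set N} (h : α ⊆ β) : X.agree β ≤ X.agree α :=
  fun {_ _} hr => X.agree_iff.2 fun i hi => X.agree_iff.1 hr i (h hi)

theorem weight_nonneg (X : RandomVars N) (ω : X.Ω) : 0 ≤ X.weight ω := ENNReal.toReal_nonneg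

theorem weight_pos_iff (X : RandomVars N) (ω : X.Ω) : 0 < X.weight ω ↔ ω ∈ X.prob.support := by
  rw [PMF.mem_support_iff, weight, ENNReal.toReal_pos_iff, pos_iff_ne_zero, and_iff_left]
  exact lt_of_le_of_ne le_top (X.prob.apply_ne_top ω)

theorem sum_weight (X : RandomVars N) : ∑ ω, X.weight ω = 1 := by
  unfold weight
  rw [← ENNReal.toReal_sum fun ω _ => X.prob.apply_ne_top ω, ← tsum_fintype (L := .unconditional _),
    X.prob.tsum_coe, ENNReal.toReal_one]

theorem map_toReal (X : RandomVars N) {T : Type*} (f : X.Ω → T) (ω : X.Ω) :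
    (X.prob.map f (f ω)).toReal = mass X.weight (Setoid.ker f) ω := by
  classical
  rw [PMF.map_apply, tsum_fintype, ENNReal.toReal_sum]
  · refine Finset.sum_congr rfl fun x _ => ?_
    change _ = if f ω = f x then _ else _
    split_ifs <;> simp [weight]
  · intro x _
    split_ifs
    · exact X.prob.apply_ne_top x
    · simp

/-- Values outside the image of `f` contribute nothing, even if `T` is infinite; grouping the
outcomes by their value turns the sum over values into one over outcomes. -/
theorem finsum_negMulLog (X : RandomVars N) {T : Type*} (f : X.Ω → T) :
    ∑ᶠ x : T, Real.negMulLog (X.prob.map f x).toReal = ent X.weight (Setoid.ker f) := by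
  classical
  have hsub : (Function.support fun x : T => Real.negMulLog (X.prob.map f x).toReal) ⊆
      ((Finset.univ.image f : Finset T) : Set T) := by
    intro x hx
    by_contra hc
    refine hx ?_
    have : X.prob.map f x = 0 := by
      rw [PMF.map_apply, ENNReal.tsum_eq_zero]
      intro ω
      rw [if_neg]
      rintro rfl
      exact hc (by simp)
    simp [this]
  rw [finsum_eq_sum_of_support_subset _ hsub, ent, ← Finset.sum_neg_distrib,
    ← Finset.sum_fiberwise_of_maps_to (s := Finset.univ) (t := Finset.univ.image f) (g := f)
      (fun ω _ => Finset.mem_image_of_mem f (Finset.mem_univ ω))]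
  refine Finset.sum_congr rfl fun x hx => ?_
  obtain ⟨ω, -, rfl⟩ := Finset.mem_image.1 hx
  have : ∀ ω' ∈ Finset.univ.filter (fun ω' => f ω' = f ω),
      -(X.weight ω' * Real.log (mass X.weight (Setoid.ker f) ω')) =
      X.weight ω' * -Real.log (mass X.weight (Setoid.ker f) ω) := by
    intro ω' h
    rw [mass_congr (r := Setoid.ker f) (show f ω' = f ω from (Finset.mem_filter.1 h).2), mul_neg]
  rw [Finset.sum_congr rfl this, ← Finset.sum_mul, map_toReal, Real.negMulLog]
  have h2 : ∑ i with f i = f ω, X.weight i = mass X.weight (Setoid.ker f) ω := by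
    rw [mass, Finset.sum_filter]
    refine Finset.sum_congr rfl fun x _ => ?_
    change _ = if f ω = f x then _ else _
    simp only [eq_comm]
  rw [h2]; ring

theorem entropy_eq (X : RandomVars N) (α : Set N) :
    X.entropy α = ent X.weight (X.agree α) :=
  X.finsum_negMulLog (X.joint α)

/-- `H(α | β) = 0` if and only if the variables in `β` determine those in `α`. -/
theorem cond_entropy_eq_zero_iff (X : RandomVars N) (α β : Set N) :
    RankFunction.cond X.entropy α β = 0 ↔ ∀ ω ∈ X.prob.support, ∀ ω' ∈ X.prob.support,
      (∀ i ∈ β, X.Y i ω = X.Y i ω') → ∀ i ∈ α, X.Y i ω = X.Y i ω' := by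
  rw [RankFunction.cond, sub_eq_zero, entropy_eq, entropy_eq,
    ent_eq_iff X.weight_nonneg (X.agree_anti Set.subset_union_right)]
  simp only [weight_pos_iff, agree_iff, Set.mem_union]
  constructor
  · intro H ω hω ω' hω' h i hi
    exact H ω ω' hω hω' h i (.inl hi)
  · intro H ω ω' hω hω' h i hi
    exact hi.elim (H ω hω ω' hω' h i) (h i)

/-! ### Random variables realizing given partitions. -/

section ofSetoids

variable {Ω : Type*} [Fintype Ω]

/-- The random variables on a finite weighted space that are given by partitions. -/
def ofSetoids (w : Ω → ℝ) (hw : ∀ ω, 0 ≤ w ω) (hs : ∑ ω, w ω = 1) (r : N → Setoid Ω) :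
    RandomVars N where
  -- `RandomVars` asks for types in `Type`, so copies of the form `Fin n` stand in for spaces of any
  -- universe.
  Ω := Fin (Fintype.card Ω)
  prob := PMF.ofFintype (fun ω => ENNReal.ofReal (w ((Fintype.equivFin Ω).symm ω))) (by
    rw [← ENNReal.ofReal_sum_of_nonneg fun _ _ => hw _, Equiv.sum_comp _ w, hs,
      ENNReal.ofReal_one])
  alphabet i := Fin (Nat.card (Quotient (r i)))
  Y i ω := Finite.equivFin (Quotient (r i)) (Quotient.mk (r i) ((Fintype.equivFin Ω).symm ω))

variable {w : Ω → ℝ} {hw : ∀ ω, 0 ≤ w ω} {hs : ∑ ω, w ω = 1} {r : N → Setoid Ω}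

/-- The sample space of `ofSetoids` is a copy of the given one. -/
def ofSetoidsEquiv (w : Ω → ℝ) (hw : ∀ ω, 0 ≤ w ω) (hs : ∑ ω, w ω = 1) (r : N → Setoid Ω) :
    (ofSetoids w hw hs r).Ω ≃ Ω :=
  (Fintype.equivFin Ω).symm

theorem ofSetoids_Y_eq_iff {i : N} {ω ω' : (ofSetoids w hw hs r).Ω} :
    (ofSetoids w hw hs r).Y i ω = (ofSetoids w hw hs r).Y i ω' ↔
      r i (ofSetoidsEquiv w hw hs r ω) (ofSetoidsEquiv w hw hs r ω') := by
  change Finite.equivFin _ _ = Finite.equivFin _ _ ↔ _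
  rw [EmbeddingLike.apply_eq_iff_eq]
  exact Quotient.eq

theorem ofSetoids_weight (ω : (ofSetoids w hw hs r).Ω) :
    (ofSetoids w hw hs r).weight ω = w (ofSetoidsEquiv w hw hs r ω) :=
  ENNReal.toReal_ofReal (hw _)

theorem ofSetoids_entropy (α : Set N) :
    (ofSetoids w hw hs r).entropy α = ent w (⨅ i ∈ α, r i) := by
  rw [entropy_eq, ← ent_comap_equiv (ofSetoidsEquiv w hw hs r) w]
  have h1 : (ofSetoids w hw hs r).weight = fun ω => w (ofSetoidsEquiv w hw hs r ω) :=
    funext ofSetoids_weight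
  have h2 : (ofSetoids w hw hs r).agree α =
      (⨅ i ∈ α, r i).comap (ofSetoidsEquiv w hw hs r) := by
    ext ω ω'
    rw [agree_iff, Setoid.comap_rel, Setoid.biInf_apply]
    simp only [ofSetoids_Y_eq_iff]
  rw [h1, h2]

theorem ofSetoids_ncard_supp (hpos : ∀ ω, 0 < w ω) (i : N) :
    ((ofSetoids w hw hs r).supp i).ncard = Nat.card (Quotient (r i)) := by
  have : (ofSetoids w hw hs r).supp i = Set.univ := by
    ext x
    rw [supp, PMF.mem_support_map_iff]
    simp only [Set.mem_univ, iff_true]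
    obtain ⟨q, rfl⟩ := (Finite.equivFin (Quotient (r i))).surjective x
    obtain ⟨ω, rfl⟩ := Quotient.exists_rep q
    refine ⟨(ofSetoidsEquiv w hw hs r).symm ω, ?_, ?_⟩
    · rw [← weight_pos_iff, ofSetoids_weight]
      exact hpos _
    · change Finite.equivFin _ (Quotient.mk _
        ((ofSetoidsEquiv w hw hs r) ((ofSetoidsEquiv w hw hs r).symm ω))) = _
      rw [Equiv.apply_symm_apply]
  rw [this, Set.ncard_univ]
  exact Nat.card_fin _

theorem ofSetoids_isUniform {i : N} (h : ∀ ω ω', mass w (r i) ω = mass w (r i) ω') :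
    (ofSetoids w hw hs r).IsUniform i := by
  have key : ∀ ω, ((ofSetoids w hw hs r).prob.map ((ofSetoids w hw hs r).Y i)
      ((ofSetoids w hw hs r).Y i ω)).toReal = mass w (r i) (ofSetoidsEquiv w hw hs r ω) := by
    classical
    intro ω
    rw [map_toReal, mass, mass]
    rw [← Equiv.sum_comp (ofSetoidsEquiv w hw hs r)
      (fun y => if r i (ofSetoidsEquiv w hw hs r ω) y then w y else 0)]
    refine Finset.sum_congr rfl fun x _ => ?_
    rw [ofSetoids_weight]
    exact if_congr ofSetoids_Y_eq_iff rfl rfl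
  intro x hx y hy
  rw [supp, PMF.mem_support_map_iff] at hx hy
  obtain ⟨ω, -, rfl⟩ := hx
  obtain ⟨ω', -, rfl⟩ := hy
  rw [← ENNReal.toReal_eq_toReal_iff' (PMF.apply_ne_top _ _) (PMF.apply_ne_top _ _), key, key]
  exact h _ _

end ofSetoids

end RandomVars

/-! # Almost entropic functions -/

/-- The polymatroid axioms. -/
structure IsPolymatroid {N : Type*} (g : RankFunction N) : Prop where
  empty : g ∅ = 0
  mono : ∀ ⦃α β⦄, α ⊆ β → g α ≤ g β
  submod : ∀ α β, g (α ∪ β) + g (α ∩ β) ≤ g α + g β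

theorem RandomVars.isPolymatroid {N : Type*} (X : RandomVars N) : IsPolymatroid X.entropy where
  empty := by
    rw [X.entropy_eq, show X.agree ∅ = ⊤ from ?_, SetoidEntropy.ent_top X.sum_weight]
    ext; simp [X.agree_iff]
  mono α β h := by
    rw [X.entropy_eq, X.entropy_eq]
    exact SetoidEntropy.ent_anti X.weight_nonneg (X.agree_anti h)
  submod α β := by
    rw [X.entropy_eq, X.entropy_eq, X.entropy_eq, X.entropy_eq, X.agree_union]
    exact SetoidEntropy.ent_submodular X.weight_nonneg X.sum_weight
      (X.agree_anti Set.inter_subset_left) (X.agree_anti Set.inter_subset_right)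

section AlmostEntropic

open SetoidEntropy

variable {N M : Type*}

theorem IsPolymatroid.smul {g : RankFunction N} (hg : IsPolymatroid g) {c : ℝ} (hc : 0 ≤ c) :
    IsPolymatroid (c • g) where
  empty := by simp [hg.empty]
  mono α β h := mul_le_mul_of_nonneg_left (hg.mono h) hc
  submod α β := by
    have := mul_le_mul_of_nonneg_left (hg.submod α β) hc
    simpa [mul_add] using this

theorem weaklyEntropic.isPolymatroid {h : RankFunction N} (hh : h ∈ weaklyEntropic N) :
    IsPolymatroid h := by
  obtain ⟨c, hc, X, hX⟩ := hh
  have : h = c⁻¹ • X.entropy := by rw [← hX, inv_smul_smul₀ hc.ne']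
  rw [this]
  exact X.isPolymatroid.smul (inv_nonneg.2 hc.le)

theorem almostEntropic.isPolymatroid {h : RankFunction N} (hh : h ∈ almostEntropic N) :
    IsPolymatroid h := by
  obtain ⟨k, hk, hlim⟩ := hh
  have hl : ∀ α, Tendsto (fun n => k n α) atTop (𝓝 (h α)) := fun α => (tendsto_pi_nhds.1 hlim) α
  exact
  { empty := tendsto_nhds_unique (hl ∅)
      (by simp [(weaklyEntropic.isPolymatroid (hk _)).empty])
    mono := fun α β hab => le_of_tendsto_of_tendsto' (hl α) (hl β)
      fun n => (weaklyEntropic.isPolymatroid (hk n)).mono hab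
    submod := fun α β => le_of_tendsto_of_tendsto' ((hl _).add (hl _)) ((hl _).add (hl _))
      fun n => (weaklyEntropic.isPolymatroid (hk n)).submod α β }

/-! ### The closed convex cone of almost entropic functions. -/

theorem almostEntropic_eq_closure [Finite N] : almostEntropic N = closure (weaklyEntropic N) := by
  ext h
  rw [mem_closure_iff_seq_limit]
  rfl

/-- Pair the two families on the product of their sample spaces: entropies of independent variables
add. -/
theorem entropic_add {h h' : RankFunction N} (hh : h ∈ entropic N) (hh' : h' ∈ entropic N) :
    h + h' ∈ entropic N := by
  obtain ⟨X, rfl⟩ := hh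
  obtain ⟨X', rfl⟩ := hh'
  refine ⟨RandomVars.ofSetoids (fun x : X.Ω × X'.Ω => X.weight x.1 * X'.weight x.2)
    (fun x => mul_nonneg (X.weight_nonneg _) (X'.weight_nonneg _)) ?_
    (fun i => (X.agree {i}).prod (X'.agree {i})), ?_⟩
  · rw [Fintype.sum_prod_type]
    simp_rw [← Finset.mul_sum, X'.sum_weight, mul_one, X.sum_weight]
  · funext α
    rw [RandomVars.ofSetoids_entropy, Pi.add_apply, X.entropy_eq, X'.entropy_eq,
      ← ent_prod X.weight_nonneg X'.weight_nonneg X.sum_weight X'.sum_weight]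
    congr 1
    ext x y
    rw [Setoid.biInf_apply]
    have : (X.agree α).prod (X'.agree α) x y ↔ X.agree α x.1 y.1 ∧ X'.agree α x.2 y.2 := Iff.rfl
    have h2 : ∀ i, (X.agree {i}).prod (X'.agree {i}) x y ↔
      X.agree {i} x.1 y.1 ∧ X'.agree {i} x.2 y.2 := fun i => Iff.rfl
    simp [this, h2, RandomVars.agree_iff, forall_and]

theorem zero_mem_entropic : (0 : RankFunction N) ∈ entropic N := by
  refine ⟨RandomVars.ofSetoids (fun _ : Unit => 1) (by simp) (by simp) (fun _ => ⊤), ?_⟩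
  funext α
  rw [RandomVars.ofSetoids_entropy]
  simp [ent_top]

theorem entropic_nsmul {h : RankFunction N} (hh : h ∈ entropic N) (n : ℕ) :
    (n : ℝ) • h ∈ entropic N := by
  induction n with
  | zero => simpa using zero_mem_entropic
  | succ n ih =>
    rw [Nat.cast_succ, add_smul, one_smul]
    exact entropic_add ih hh

theorem weaklyEntropic_smul {h : RankFunction N} (hh : h ∈ weaklyEntropic N) {c : ℝ}
    (hc : 0 < c) : c • h ∈ weaklyEntropic N := by
  obtain ⟨d, hd, hX⟩ := hh
  refine ⟨d / c, div_pos hd hc, ?_⟩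
  rwa [smul_smul, div_mul_cancel₀ _ hc.ne']

theorem entropic_subset_almostEntropic [Finite N] : entropic N ⊆ almostEntropic N := by
  rw [almostEntropic_eq_closure]
  exact fun h hh => subset_closure ⟨1, one_pos, by simpa using hh⟩

theorem almostEntropic_smul [Finite N] {h : RankFunction N} (hh : h ∈ almostEntropic N) {c : ℝ}
    (hc : 0 ≤ c) : c • h ∈ almostEntropic N := by
  rcases hc.eq_or_lt with rfl | hc
  · rw [zero_smul]; exact entropic_subset_almostEntropic zero_mem_entropic
  rw [almostEntropic_eq_closure] at hh ⊢
  exact map_mem_closure (f := fun h => c • h) (continuous_const_smul c) hh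
    fun k hk => weaklyEntropic_smul hk hc

theorem almostEntropic_add [Finite N] {h h' : RankFunction N} (hh : h ∈ almostEntropic N)
    (hh' : h' ∈ almostEntropic N) : h + h' ∈ almostEntropic N := by
  rw [almostEntropic_eq_closure] at hh hh'
  have : h + h' ∈ closure (almostEntropic N) := by
    refine map_mem_closure₂ continuous_add hh hh' ?_
    rintro k ⟨c, hc, hk⟩ k' ⟨c', hc', hk'⟩
    -- The entropic functions `c • k` and `c' • k'` have unrelated scales, and only integer
    -- multiples stay entropic. The floors divided by `n + 1` tend to `c⁻¹` and `c'⁻¹`, so these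
    -- weakly entropic functions tend to `k + k'`.
    refine ⟨fun n => ((n : ℝ) + 1)⁻¹ • ((⌊c⁻¹ * ((n : ℝ) + 1)⌋₊ : ℝ) • c • k +
      (⌊c'⁻¹ * ((n : ℝ) + 1)⌋₊ : ℝ) • c' • k'), fun n => ?_, ?_⟩
    · refine weaklyEntropic_smul ⟨1, one_pos, ?_⟩ (by positivity)
      rw [one_smul]
      exact entropic_add (entropic_nsmul hk _) (entropic_nsmul hk' _)
    · have hn : Tendsto (fun n : ℕ => (n : ℝ) + 1) atTop atTop :=
        tendsto_atTop_add_const_right _ _ tendsto_natCast_atTop_atTop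
      have key : ∀ {d : ℝ}, 0 < d → ∀ l : RankFunction N, Tendsto (fun n : ℕ =>
          ((⌊d⁻¹ * ((n : ℝ) + 1)⌋₊ : ℝ) / ((n : ℝ) + 1)) • d • l) atTop (𝓝 l) := by
        intro d hd l
        have h1 := (tendsto_nat_floor_mul_div_atTop (inv_nonneg.2 hd.le)).comp hn
        have h2 := h1.smul_const (d • l)
        rwa [inv_smul_smul₀ hd.ne'] at h2
      refine ((key hc k).add (key hc' k')).congr fun n => ?_
      rw [smul_add, smul_smul _ _ (c • k), smul_smul _ _ (c' • k'), div_eq_inv_mul, div_eq_inv_mul]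
  rwa [almostEntropic_eq_closure, closure_closure, ← almostEntropic_eq_closure] at this

theorem almostEntropic_sum [Finite N] {ι : Type*} (s : Finset ι) (f : ι → RankFunction N)
    (hf : ∀ i ∈ s, f i ∈ almostEntropic N) : ∑ i ∈ s, f i ∈ almostEntropic N := by
  classical
  induction s using Finset.induction_on with
  | empty => simpa using entropic_subset_almostEntropic zero_mem_entropic
  | insert a s ha ih =>
    rw [Finset.sum_insert ha]
    exact almostEntropic_add (hf a (Finset.mem_insert_self a s))
      (ih fun i hi => hf i (Finset.mem_insert_of_mem hi))

/-! ### Conditioning of almost entropic functions. -/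

/-- Conditioning on `β`, together with a relabelling of the variables. -/
def RankFunction.contract (h : RankFunction N) (σ : M → N) (β : Set N) : RankFunction M :=
  fun α => h (σ '' α ∪ β) - h β

theorem RandomVars.contract_mem_almostEntropic [Finite M] (X : RandomVars N) (σ : M → N)
    (β : Set N) : RankFunction.contract X.entropy σ β ∈ almostEntropic M := by
  classical
  let f : X.Ω → RankFunction M := fun ω α =>
    ent (condWeight X.weight (X.agree β) ω) (X.agree (σ '' α))
  have : RankFunction.contract X.entropy σ β = ∑ ω, X.weight ω • f ω := by
    funext α
    rw [RankFunction.contract, X.entropy_eq, X.entropy_eq, X.agree_union,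
      ent_inf_sub X.weight_nonneg, Finset.sum_apply]
    rfl
  rw [this]
  refine almostEntropic_sum _ _ fun ω _ => ?_
  rcases (X.weight_nonneg ω).eq_or_lt with h | h
  · rw [← h, zero_smul]; exact entropic_subset_almostEntropic zero_mem_entropic
  refine almostEntropic_smul (entropic_subset_almostEntropic ?_) h.le
  refine ⟨RandomVars.ofSetoids (condWeight X.weight (X.agree β) ω)
    (condWeight_nonneg X.weight_nonneg _ ω) (sum_condWeight X.weight_nonneg _ h)
    (fun i => X.agree {σ i}), ?_⟩
  funext α
  rw [RandomVars.ofSetoids_entropy]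
  change ent _ _ = _
  congr 1
  ext x y
  rw [Setoid.biInf_apply]
  simp [RandomVars.agree_iff]

theorem contract_mem_almostEntropic [Finite M] {h : RankFunction N}
    (hh : h ∈ almostEntropic N) (σ : M → N) (β : Set N) :
    h.contract σ β ∈ almostEntropic M := by
  obtain ⟨k, hk, hlim⟩ := hh
  have hl : ∀ α, Tendsto (fun n => k n α) atTop (𝓝 (h α)) := fun α => (tendsto_pi_nhds.1 hlim) α
  have h1 : h.contract σ β ∈ closure (almostEntropic M) := by
    refine mem_closure_of_tendsto (f := fun n => (k n).contract σ β) (b := atTop)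
      (tendsto_pi_nhds.2 fun α => (hl _).sub (hl _)) (Eventually.of_forall fun n => ?_)
    obtain ⟨c, hc, X, hX⟩ := hk n
    have : (k n).contract σ β = c⁻¹ • RankFunction.contract X.entropy σ β := by
      funext α
      have h2 : ∀ γ, X.entropy γ = c * k n γ := fun γ => by rw [← hX]; rfl
      simp only [RankFunction.contract, Pi.smul_apply, h2, smul_eq_mul]
      field_simp
    rw [this]
    exact almostEntropic_smul (X.contract_mem_almostEntropic σ β) (inv_nonneg.2 hc.le)
  rwa [almostEntropic_eq_closure, closure_closure, ← almostEntropic_eq_closure] at h1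

end AlmostEntropic

/-! # Functional dependence and independence in polymatroids -/

namespace RankFunction

variable {N : Type*}

/-- The variables in `α` are determined by those in `β`. -/
def Det (g : RankFunction N) (α β : Set N) : Prop := g (α ∪ β) = g β

/-- The variables in `α` are independent of those in `β`. -/
def Ind (g : RankFunction N) (α β : Set N) : Prop := g (α ∪ β) = g α + g β

end RankFunction

namespace IsPolymatroid

open RankFunction

variable {N : Type*} {g : RankFunction N} {α α' β γ κ : Set N}

theorem nonneg (hg : IsPolymatroid g) (α : Set N) : 0 ≤ g α :=
  hg.empty ▸ hg.mono (Set.empty_subset α)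

theorem union_le (hg : IsPolymatroid g) (α β : Set N) : g (α ∪ β) ≤ g α + g β :=
  by linarith [hg.submod α β, hg.nonneg (α ∩ β)]

theorem det_of_le (hg : IsPolymatroid g) (h : g (α ∪ β) ≤ g β) : Det g α β :=
  h.antisymm (hg.mono Set.subset_union_right)

theorem det_of_subset (_ : IsPolymatroid g) (h : α ⊆ β) : Det g α β := by
  rw [Det, Set.union_eq_self_of_subset_left h]

theorem det_mono_right (hg : IsPolymatroid g) (h : Det g α β) (hs : β ⊆ γ) : Det g α γ := by
  refine hg.det_of_le ?_
  have h1 := hg.submod (α ∪ β) γ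
  have h2 : g (α ∪ γ) ≤ g (α ∪ β ∪ γ) := hg.mono (by grind)
  have h3 : g β ≤ g ((α ∪ β) ∩ γ) := hg.mono (by grind)
  rw [Det] at h
  linarith

theorem det_union (hg : IsPolymatroid g) (h : Det g α γ) (h' : Det g β γ) : Det g (α ∪ β) γ := by
  have := hg.det_mono_right h (show γ ⊆ β ∪ γ from Set.subset_union_right)
  rw [Det] at *
  rw [Set.union_assoc, this, h']

theorem det_mono_left (hg : IsPolymatroid g) (h : Det g α β) (hs : α' ⊆ α) : Det g α' β :=
  hg.det_of_le ((hg.mono (Set.union_subset_union_left β hs)).trans (le_of_eq h))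

theorem det_trans (hg : IsPolymatroid g) (h : Det g α β) (h' : Det g β γ) : Det g α γ := by
  have h1 := hg.det_mono_right h (show β ⊆ β ∪ γ from Set.subset_union_left)
  refine hg.det_of_le ?_
  have h2 : g (α ∪ γ) ≤ g (α ∪ (β ∪ γ)) := hg.mono (by grind)
  rw [Det] at *
  linarith

theorem det_le (hg : IsPolymatroid g) (h : Det g α β) : g α ≤ g β :=
  (hg.mono Set.subset_union_left).trans (le_of_eq h)

theorem det_of_forall [Finite N] (hg : IsPolymatroid g) (h : ∀ i ∈ α, Det g {i} β) :
    Det g α β := by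
  induction α, Set.toFinite α using Set.Finite.induction_on with
  | empty => exact hg.det_of_subset (Set.empty_subset β)
  | insert _ _ ih =>
    rw [Set.insert_eq]
    exact hg.det_union (h _ (Set.mem_insert _ _)) (ih fun i hi => h i (Set.mem_insert_of_mem _ hi))

theorem det_symm_of_le (hg : IsPolymatroid g) (h : Det g α β) (h' : g β ≤ g α) : Det g β α := by
  refine hg.det_of_le ?_
  rw [Det] at h
  rw [Set.union_comm, h]
  exact h'

theorem ind_of_le (hg : IsPolymatroid g) (h : g α + g β ≤ g (α ∪ β)) : Ind g α β :=
  (hg.union_le α β).antisymm h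

theorem ind_symm (_ : IsPolymatroid g) (h : Ind g α β) : Ind g β α := by
  rw [Ind] at *; rw [Set.union_comm, h, add_comm]

theorem ind_left (hg : IsPolymatroid g) (h : Ind g α β) (h' : Det g α' α) : Ind g α' β := by
  refine hg.ind_of_le ?_
  have h1 := hg.submod (α' ∪ β) (α' ∪ α)
  have h2 : g (α ∪ β) ≤ g (α' ∪ β ∪ (α' ∪ α)) := hg.mono (by grind)
  have h3 : g α' ≤ g ((α' ∪ β) ∩ (α' ∪ α)) := hg.mono (by grind)
  rw [Ind] at h
  rw [Det] at h'
  linarith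

theorem ind_right (hg : IsPolymatroid g) (h : Ind g α β) (h' : Det g α' β) : Ind g α α' :=
  hg.ind_symm (hg.ind_left (hg.ind_symm h) h')

/-- Variables independent of everything else do not help to determine something. -/
theorem det_drop (hg : IsPolymatroid g) (h : Det g α (β ∪ κ)) (h' : Ind g (α ∪ β) κ) :
    Det g α β := by
  have h1 := hg.ind_left h' (hg.det_of_subset (show β ⊆ α ∪ β from Set.subset_union_right))
  rw [Det, ← Set.union_assoc] at h
  rw [Ind] at h' h1
  rw [Det]
  linarith

/-- If `γ` is a function of `α` and `β`, independent of `α`, and of entropy at least that of `β`,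
then `β` is a function of `α` and `γ`. -/
theorem det_swap (hg : IsPolymatroid g) (h : Det g γ (α ∪ β)) (h' : Ind g γ α)
    (hle : g β ≤ g γ) : Det g β (α ∪ γ) := by
  refine hg.det_of_le ?_
  have h1 := hg.union_le α β
  rw [Det] at h
  rw [Ind] at h'
  rw [show β ∪ (α ∪ γ) = γ ∪ (α ∪ β) by grind, h, Set.union_comm α γ, h']
  linarith

theorem image_le_sum (hg : IsPolymatroid g) {ι : Type*} (k : ι → N) (s : Finset ι) :
    g (k '' s) ≤ ∑ i ∈ s, g {k i} := by
  classical
  induction s using Finset.induction_on with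
  | empty => simp [hg.empty]
  | insert a s ha ih =>
    rw [Finset.sum_insert ha, Finset.coe_insert, Set.image_insert_eq, Set.insert_eq]
    exact (hg.union_le _ _).trans (by linarith)

theorem range_le_sum (hg : IsPolymatroid g) {ι : Type*} [Fintype ι] (k : ι → N) :
    g (Set.range k) ≤ ∑ i, g {k i} := by
  simpa using hg.image_le_sum k Finset.univ

/-- Full additivity leaves no slack in subadditivity, so a strict inequality for disjoint
subfamilies would contradict it. -/
theorem ind_of_sum (hg : IsPolymatroid g) {ι : Type*} [Fintype ι] {k : ι → N}
    (h : g (α ∪ Set.range k) = g α + ∑ i, g {k i}) {U W : Set ι} (hd : Disjoint U W) :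
    Ind g (α ∪ k '' U) (k '' W) := by
  classical
  refine hg.ind_of_le ?_
  have e : ∀ X : Set ι, g (k '' X) ≤ ∑ i, X.indicator (fun i => g {k i}) i := fun X => by
    simp only [Set.indicator_apply]
    rw [← Finset.sum_filter]
    simpa using hg.image_le_sum k (Finset.univ.filter (· ∈ X))
  have h1 : g (α ∪ Set.range k) ≤ g (α ∪ k '' U ∪ k '' W) + g (k '' (U ∪ W)ᶜ) := by
    refine le_trans (hg.mono ?_) (hg.union_le _ _)
    rintro x (hx | ⟨i, rfl⟩)
    · exact .inl (.inl (.inl hx))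
    · by_cases hU : i ∈ U
      · exact .inl (.inl (.inr ⟨i, hU, rfl⟩))
      by_cases hW : i ∈ W
      · exact .inl (.inr ⟨i, hW, rfl⟩)
      · exact .inr ⟨i, by simp [hU, hW], rfl⟩
  have h2 : ∑ i, g {k i} = (∑ i, U.indicator (fun i => g {k i}) i) +
      (∑ i, W.indicator (fun i => g {k i}) i) + ∑ i, (U ∪ W)ᶜ.indicator (fun i => g {k i}) i := by
    rw [← Finset.sum_add_distrib, ← Finset.sum_add_distrib]
    refine Finset.sum_congr rfl fun i _ => ?_
    by_cases hU : i ∈ U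
    · have := Set.disjoint_left.1 hd hU
      simp [hU, this]
    · by_cases hW : i ∈ W <;> simp [hU, hW]
  linarith [hg.union_le α (k '' U), e U, e W, e (U ∪ W)ᶜ]

end IsPolymatroid

/-! # The outer bound -/

namespace NetworkProblem

open RankFunction

variable {V E S : Type*}

instance (P : NetworkProblem V E S) [Finite V] [Finite E] [Finite S] : Finite P.SecEdge :=
  Finite.of_injective
    (fun x : P.SecEdge => (match x with
      | .old e => .inl e
      | .a s => .inr (.inl (s, 0))
      | .b s => .inr (.inl (s, 1))
      | .c s => .inr (.inl (s, 2))
      | .e s => .inr (.inl (s, 3))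
      | .d q => .inr (.inr (q, true))
      | .w q => .inr (.inr (q, false)) :
        E ⊕ (S × Fin 4) ⊕ (P.Demand × Bool)))
    (by intro x y h; cases x <;> cases y <;> simp_all)

/-- The index of the source of the secure problem. -/
abbrev msg (P : NetworkProblem V E S) : (Unit ⊕ P.SecEdge) ⊕ P.SecNode := .inl (.inl ())

/-- The index of a hyperedge of the secure problem. -/
abbrev edge (P : NetworkProblem V E S) (x : P.SecEdge) : (Unit ⊕ P.SecEdge) ⊕ P.SecNode :=
  .inl (.inr x)

/-- The index of a random key of the secure problem. -/
abbrev key (P : NetworkProblem V E S) (u : P.SecNode) : (Unit ⊕ P.SecEdge) ⊕ P.SecNode := .inr u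

theorem range_msg (P : NetworkProblem V E S) : Set.range (fun s : Unit =>
    (Sum.inl (Sum.inl s) : (Unit ⊕ P.SecEdge) ⊕ P.SecNode)) = {P.msg} := by
  ext x
  exact ⟨by rintro ⟨⟨⟩, rfl⟩; rfl, by rintro rfl; exact ⟨(), rfl⟩⟩

variable [Fintype V] [Fintype S]

/-- A polymatroid that satisfies the constraints of the secure problem and whose projection is
dominated by the induced tuple of `t`. -/
structure IsSecureWitness (P : NetworkProblem V E S) (t : RateCapacity S E)
    (g : RankFunction ((Unit ⊕ P.SecEdge) ⊕ P.SecNode)) : Prop where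
  poly : IsPolymatroid g
  ci : g ∈ P.toSecure.CI
  ct : g ∈ P.toSecure.CT
  cd : g ∈ P.toSecure.CD
  cs : g ∈ P.toSecure.CS
  rate : ∑ s, t.rate s ≤ g {P.msg}
  cap : ∀ x, g {P.edge x} ≤ (P.toSecureTuple t).cap x

namespace IsSecureWitness

variable {P : NetworkProblem V E S} {t : RateCapacity S E}
  {g : RankFunction ((Unit ⊕ P.SecEdge) ⊕ P.SecNode)}

/-- All the hyperedges `a s`. -/
abbrev allA (P : NetworkProblem V E S) : Set ((Unit ⊕ P.SecEdge) ⊕ P.SecNode) :=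
  Set.range fun s => P.edge (.a s)

/-- All the hyperedges `b s`. -/
abbrev allB (P : NetworkProblem V E S) : Set ((Unit ⊕ P.SecEdge) ⊕ P.SecNode) :=
  Set.range fun s => P.edge (.b s)

/-- The keys of the nodes of `P`. -/
abbrev oldKeys (P : NetworkProblem V E S) : Set ((Unit ⊕ P.SecEdge) ⊕ P.SecNode) :=
  P.key '' Set.range SecNode.old

/-- The keys of the new nodes other than `phi`. -/
abbrev newKeys (P : NetworkProblem V E S) : Set ((Unit ⊕ P.SecEdge) ⊕ P.SecNode) :=
  P.key '' {u | u ∉ Set.range SecNode.old ∧ u ≠ .phi}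

/-- The keys of the nodes other than `phi`. -/
abbrev otherKeys (P : NetworkProblem V E S) : Set ((Unit ⊕ P.SecEdge) ⊕ P.SecNode) :=
  P.key '' {u | u ≠ .phi}

theorem otherKeys_eq : otherKeys P = oldKeys P ∪ newKeys P := by
  rw [otherKeys, ← Set.image_union]
  congr 1
  ext u
  cases u <;> simp

/-! ### What secrecy and decoding at `eta` force. -/

theorem det_edge (hg : P.IsSecureWitness t g) (x : P.SecEdge)
    {β : Set ((Unit ⊕ P.SecEdge) ⊕ P.SecNode)}
    (hm : P.secTail x = .phi → P.msg ∈ β)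
    (he : ∀ y, P.secTail x ∈ P.secHead y → P.edge y ∈ β) (hk : P.key (P.secTail x) ∈ β) :
    Det g {P.edge x} β := by
  refine hg.poly.det_mono_right (sub_eq_zero.1 (hg.ct x)) (Set.union_subset ?_ ?_)
  · rintro _ ⟨(⟨⟩ | y), hf, rfl⟩
    · exact hm hf
    · exact he y hf
  · rintro _ rfl
    exact hk

theorem det_msg (hg : P.IsSecureWitness t g) {u : P.SecNode} (hu : u ∈ P.toSecure.D ())
    {β : Set ((Unit ⊕ P.SecEdge) ⊕ P.SecNode)}
    (he : ∀ y, u ∈ P.secHead y → P.edge y ∈ β) : Det g {P.msg} β := by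
  refine hg.poly.det_mono_right (sub_eq_zero.1 (hg.cd () u hu)) ?_
  rintro _ ⟨(⟨⟩ | y), hf, rfl⟩
  · have : u = .phi := hf
    subst this
    simp [toSecure] at hu
  · exact he y hf

theorem ind_msg_allA (hg : P.IsSecureWitness t g) : Ind g {P.msg} (allA P) := by
  have h := hg.cs 0
  change g (_ '' Set.univ) + g (_ '' Set.range SecEdge.a) -
    g (_ '' Set.univ ∪ _ '' Set.range SecEdge.a) = 0 at h
  rw [Set.image_univ, range_msg, ← Set.range_comp] at h
  exact (sub_eq_zero.1 h).symm

theorem ind_msg_allB (hg : P.IsSecureWitness t g) : Ind g {P.msg} (allB P) := by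
  have h := hg.cs 1
  change g (_ '' Set.univ) + g (_ '' Set.range SecEdge.b) -
    g (_ '' Set.univ ∪ _ '' Set.range SecEdge.b) = 0 at h
  rw [Set.image_univ, range_msg, ← Set.range_comp] at h
  exact (sub_eq_zero.1 h).symm

theorem allA_le (hg : P.IsSecureWitness t g) : g (allA P) ≤ ∑ s, g {P.edge (.a s)} :=
  hg.poly.range_le_sum _

theorem cap_a (hg : P.IsSecureWitness t g) (s : S) : g {P.edge (.a s)} ≤ t.rate s :=
  hg.cap (.a s)

theorem cap_b (hg : P.IsSecureWitness t g) (s : S) : g {P.edge (.b s)} ≤ t.rate s :=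
  hg.cap (.b s)

theorem sum_a_le (hg : P.IsSecureWitness t g) : ∑ s, g {P.edge (.a s)} ≤ ∑ s, t.rate s :=
  Finset.sum_le_sum fun s _ => hg.cap_a s

theorem allB_le (hg : P.IsSecureWitness t g) : g (allB P) ≤ ∑ s, t.rate s :=
  (hg.poly.range_le_sum _).trans (Finset.sum_le_sum fun s _ => hg.cap_b s)

theorem det_msg_eta (hg : P.IsSecureWitness t g) : Det g {P.msg} (allA P ∪ allB P) := by
  refine hg.det_msg (u := .eta) (by simp [toSecure]) fun y hy => ?_
  cases y <;> simp_all [secHead]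

/-- Since `eta` decodes, adding the message to A and B costs nothing; secrecy then splits off its
entropy from that of A alone, or of B alone. -/
theorem msg_le (hg : P.IsSecureWitness t g) :
    g {P.msg} + g (allA P) ≤ g (allA P ∪ allB P) ∧
    g {P.msg} + g (allB P) ≤ g (allA P ∪ allB P) := by
  have h0 := hg.det_msg_eta
  have h1 := hg.ind_msg_allA
  have h2 := hg.ind_msg_allB
  rw [Det] at h0
  rw [Ind] at h1 h2
  rw [← h0, ← h1, ← h2]
  exact ⟨hg.poly.mono (by grind), hg.poly.mono (by grind)⟩

theorem tight (hg : P.IsSecureWitness t g) : g {P.msg} = ∑ s, t.rate s ∧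
    g (allA P) = ∑ s, t.rate s ∧ g (allB P) = ∑ s, t.rate s := by
  have h1 := hg.msg_le
  have h2 := hg.poly.union_le (allA P) (allB P)
  have h3 := hg.rate
  have h4 := hg.allA_le
  have h5 := hg.sum_a_le
  have h6 := hg.allB_le
  refine ⟨?_, ?_, ?_⟩ <;> linarith

theorem ind_allA_allB (hg : P.IsSecureWitness t g) : Ind g (allA P) (allB P) :=
  hg.poly.ind_of_le (by linarith [hg.msg_le, hg.tight])

theorem allA_eq_sum (hg : P.IsSecureWitness t g) : g (allA P) = ∑ s, g {P.edge (.a s)} := by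
  linarith [hg.allA_le, hg.sum_a_le, hg.tight]

theorem a_eq (hg : P.IsSecureWitness t g) (s : S) : g {P.edge (.a s)} = t.rate s := by
  refine (Finset.sum_eq_sum_iff_of_le fun s _ => hg.cap_a s).1 ?_ s (Finset.mem_univ s)
  rw [← hg.allA_eq_sum, hg.tight.2.1]

theorem ind_sum (hg : P.IsSecureWitness t g) :
    g ({P.msg} ∪ Set.range P.key) = g {P.msg} + ∑ u, g {P.key u} := by
  have h := hg.ci
  simp only [SecureProblem.CI, Set.mem_ofPred_eq, range_msg] at h
  simpa using h

theorem ind_phi_otherKeys (hg : P.IsSecureWitness t g) :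
    Ind g {P.msg, P.key .phi} (otherKeys P) := by
  have := hg.poly.ind_of_sum hg.ind_sum (U := {SecNode.phi}) (W := {u | u ≠ .phi})
    (by simp)
  rwa [Set.image_singleton, Set.singleton_union] at this

theorem ind_oldKeys_newKeys (hg : P.IsSecureWitness t g) : Ind g (oldKeys P) (newKeys P) := by
  have := hg.poly.ind_of_sum hg.ind_sum (U := Set.range SecNode.old)
    (W := {u | u ∉ Set.range SecNode.old ∧ u ≠ .phi})
    (by rw [Set.disjoint_left]; intro u hu hu'; exact hu'.1 hu)
  exact hg.poly.ind_left this (hg.poly.det_of_subset Set.subset_union_right)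

variable [Fintype E]

/-- No hyperedge enters `phi`, so all that it sends depends on the message and its own key only. -/
theorem det_phi (hg : P.IsSecureWitness t g) :
    Det g ({P.msg} ∪ allA P ∪ allB P) {P.msg, P.key .phi} := by
  have key : ∀ x : P.SecEdge, P.secTail x = .phi → Det g {P.edge x} {P.msg, P.key .phi} := by
    intro x hx
    refine hg.det_edge x (fun _ => by simp) (fun y hy => ?_) (by simp [hx])
    rw [hx] at hy
    cases y <;> simp [secHead] at hy
  refine hg.poly.det_of_forall ?_
  rintro i ((rfl | ⟨s, rfl⟩) | ⟨s, rfl⟩)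
  · exact hg.poly.det_of_subset (by simp)
  · exact key _ rfl
  · exact key _ rfl

theorem ind_otherKeys (hg : P.IsSecureWitness t g) :
    Ind g ({P.msg} ∪ allA P ∪ allB P) (otherKeys P) :=
  hg.poly.ind_left hg.ind_phi_otherKeys hg.det_phi

/-- A, B, the old keys and the new keys are mutually independent blocks; this grouping is the one
needed in `det_a_d`. -/
theorem ind_allA_oldKeys (hg : P.IsSecureWitness t g) :
    Ind g (allA P ∪ oldKeys P) (allB P ∪ newKeys P) := by
  refine hg.poly.ind_of_le ?_
  have h1 := hg.poly.ind_left hg.ind_otherKeys (hg.poly.det_of_subset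
    (show allA P ∪ allB P ⊆ {P.msg} ∪ allA P ∪ allB P by grind))
  have h2 := hg.ind_allA_allB
  have h3 := hg.ind_oldKeys_newKeys
  rw [otherKeys_eq] at h1
  rw [Ind] at h1 h2 h3
  rw [show allA P ∪ oldKeys P ∪ (allB P ∪ newKeys P) =
    allA P ∪ allB P ∪ (oldKeys P ∪ newKeys P) by grind, h1, h2, h3]
  linarith [hg.poly.union_le (allA P) (oldKeys P), hg.poly.union_le (allB P) (newKeys P)]

theorem ind_allA_keys (hg : P.IsSecureWitness t g) : Ind g (allA P) (oldKeys P) := by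
  have h := hg.poly.ind_left hg.ind_otherKeys (hg.poly.det_of_subset
    (show allA P ⊆ {P.msg} ∪ allA P ∪ allB P by grind))
  exact hg.poly.ind_right h (hg.poly.det_of_subset (by rw [otherKeys_eq]; grind))

/-! ### Dependences among the new hyperedges. -/

theorem cap_e (hg : P.IsSecureWitness t g) (s : S) :
    t.rate s + g {P.edge (.e s)} ≤ ∑ s, t.rate s := by
  classical
  have h := hg.cap (.e s)
  simp only [toSecureTuple] at h
  rw [← Finset.add_sum_erase _ _ (Finset.mem_univ s)]
  convert add_le_add_right h (t.rate s)

/-- A hyperedge of capacity `t.rate s` that, together with `e s`, determines the message. -/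
theorem det_of_psi (hg : P.IsSecureWitness t g) {s : S} {x : P.SecEdge}
    (h : Det g {P.msg} {P.edge x, P.edge (.e s)}) (hx : g {P.edge x} ≤ t.rate s) :
    Det g {P.edge x} {P.msg} ∧ t.rate s ≤ g {P.edge x} := by
  have h1 := hg.cap_e s
  have h2 := hg.poly.union_le {P.edge x} {P.edge (.e s)}
  rw [Set.singleton_union] at h2
  have h3 := hg.tight.1
  have h4 := hg.poly.det_le h
  -- The pair can hold at most ∑ λ, which is exactly the entropy of the message that it determines;
  -- hence the message determines the pair as well, and neither capacity has slack.
  exact ⟨hg.poly.det_mono_left (hg.poly.det_symm_of_le h (by linarith)) (by simp), by linarith⟩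

theorem c_props (hg : P.IsSecureWitness t g) (s : S) :
    Det g {P.edge (.c s)} {P.msg} ∧ t.rate s ≤ g {P.edge (.c s)} := by
  refine hg.det_of_psi (hg.det_msg (u := .psi s) (by simp [toSecure]) fun y hy => ?_)
    (hg.cap (.c s))
  cases y <;> simp_all [secHead]

theorem w_props (hg : P.IsSecureWitness t g) (q : P.Demand) :
    Det g {P.edge (.w q)} {P.msg} ∧ t.rate q.1.1 ≤ g {P.edge (.w q)} := by
  refine hg.det_of_psi (hg.det_msg (u := .tau q) (by simp [toSecure]) fun y hy => ?_)
    (hg.cap (.w q))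
  cases y <;> simp_all [secHead]

/-- Both `α` and `β` are functions of the message, A and B, which are independent of all keys except
that of `phi`; so those keys cannot help. -/
theorem det_of_msg_ind_keys (hg : P.IsSecureWitness t g)
    {α β : Set ((Unit ⊕ P.SecEdge) ⊕ P.SecNode)} (hα : Det g α {P.msg})
    (hβ : β ⊆ allA P ∪ allB P) (h : Det g α (β ∪ otherKeys P)) : Det g α β := by
  refine hg.poly.det_drop h (hg.poly.ind_left hg.ind_otherKeys (hg.poly.det_union ?_ ?_))
  · exact hg.poly.det_mono_right hα (by grind)
  · exact hg.poly.det_of_subset (by grind)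

theorem det_c (hg : P.IsSecureWitness t g) (s : S) :
    Det g {P.edge (.c s)} {P.edge (.a s), P.edge (.b s)} := by
  refine hg.det_of_msg_ind_keys (hg.c_props s).1 ?_ (hg.det_edge _ ?_ (fun y hy => ?_) ?_)
  · rintro _ (rfl | rfl)
    · exact .inl ⟨s, rfl⟩
    · exact .inr ⟨s, rfl⟩
  · simp [secTail]
  · cases y <;> simp_all [secHead, secTail]
  · simp [secTail]

/-- One-time pad inversion: `c s` is a function of the message, hence independent of `b s`, and has
at least the entropy of `a s`. -/
theorem det_a (hg : P.IsSecureWitness t g) (s : S) :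
    Det g {P.edge (.a s)} {P.edge (.b s), P.edge (.c s)} := by
  have h := hg.poly.det_swap (α := {P.edge (.b s)}) (β := {P.edge (.a s)})
    (γ := {P.edge (.c s)}) ?_ ?_ ?_
  · rwa [Set.singleton_union] at h
  · rw [Set.singleton_union, Set.pair_comm]
    exact hg.det_c s
  · exact hg.poly.ind_left (hg.poly.ind_right hg.ind_msg_allB
      (hg.poly.det_of_subset (by simp))) (hg.c_props s).1
  · exact (hg.cap_a s).trans (hg.c_props s).2

theorem det_old (hg : P.IsSecureWitness t g) (e : E) :
    Det g {P.edge (.old e)} (allA P ∪ oldKeys P) := by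
  -- Acyclicity and finiteness of `E` allow induction from the upstream hyperedges.
  have wf : WellFounded (Relation.TransGen fun f f' : E => P.tail f' ∈ P.head f) := by
    have : Std.Irrefl (Relation.TransGen fun f f' : E => P.tail f' ∈ P.head f) := ⟨P.acyclic⟩
    exact Finite.wellFounded_of_trans_of_irrefl _
  induction e using wf.induction with
  | _ e ih =>
    let β := {x | Det g {x} (allA P ∪ oldKeys P)}
    have hβ : Det g β (allA P ∪ oldKeys P) := hg.poly.det_of_forall fun _ hx => hx
    refine hg.poly.det_trans (hg.det_edge (.old e) (β := β) ?_ (fun y hy => ?_) ?_) hβ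
    · simp [secTail]
    · cases y with
      | old f =>
        refine ih f (.single ?_)
        simpa [secTail, secHead] using hy
      | a s => exact hg.poly.det_of_subset (by simp)
      | _ => simp [secTail, secHead] at hy
    · exact hg.poly.det_of_subset (by simp [secTail])

theorem det_d (hg : P.IsSecureWitness t g) (q : P.Demand) :
    Det g {P.edge (.d q)} (allA P ∪ oldKeys P) := by
  let β := {x | Det g {x} (allA P ∪ oldKeys P)}
  have hβ : Det g β (allA P ∪ oldKeys P) := hg.poly.det_of_forall fun _ hx => hx
  refine hg.poly.det_trans (hg.det_edge (.d q) (β := β) ?_ (fun y hy => ?_) ?_) hβ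
  · simp [secTail]
  · cases y with
    | old f => exact hg.det_old f
    | a s => exact hg.poly.det_of_subset (by simp)
    | _ => simp [secTail, secHead] at hy
  · exact hg.poly.det_of_subset (by simp [secTail])

theorem det_w (hg : P.IsSecureWitness t g) (q : P.Demand) :
    Det g {P.edge (.w q)} ({P.edge (.d q), P.edge (.b q.1.1)} ∪ newKeys P) := by
  refine hg.det_edge (.w q) ?_ (fun y hy => ?_) ?_
  · simp [secTail]
  · cases y <;> simp_all [secHead, secTail]
  · simp [secTail]

/-- Given A, the hyperedges `b s` and `w q` determine each other by pad inversion, so A and `w q`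
determine `c s`. Both `c s` and `w q` are functions of the message, which is independent of A, so A
can be dropped. -/
theorem det_c_w (hg : P.IsSecureWitness t g) (q : P.Demand) :
    Det g {P.edge (.c q.1.1)} {P.edge (.w q)} := by
  have h1 : Det g {P.edge (.w q)} (allA P ∪ {P.edge (.b q.1.1)}) := by
    refine hg.det_of_msg_ind_keys (hg.w_props q).1
      (Set.union_subset_union_right _ (by simp)) (hg.poly.det_trans (hg.det_w q) ?_)
    refine hg.poly.det_of_forall ?_
    rintro i ((rfl | rfl) | hi)
    · exact hg.poly.det_mono_right (hg.det_d q) (by rw [otherKeys_eq]; grind)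
    · exact hg.poly.det_of_subset (by simp)
    · exact hg.poly.det_of_subset (by rw [otherKeys_eq]; grind)
  have h2 : Det g {P.edge (.b q.1.1)} (allA P ∪ {P.edge (.w q)}) :=
    hg.poly.det_swap h1 (hg.poly.ind_left hg.ind_msg_allA (hg.w_props q).1)
      ((hg.cap_b _).trans (hg.w_props q).2)
  have h3 : Det g {P.edge (.c q.1.1)} ({P.edge (.w q)} ∪ allA P) := by
    rw [Set.union_comm]
    refine hg.poly.det_trans (hg.det_c q.1.1) (hg.poly.det_of_forall ?_)
    rintro i (rfl | rfl)
    · exact hg.poly.det_of_subset (by simp)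
    · exact h2
  exact hg.poly.det_drop h3 (hg.poly.ind_left hg.ind_msg_allA
    (hg.poly.det_union (hg.c_props _).1 (hg.w_props q).1))

/-- In the recovery of `a s` from `b s` and `c s`, replace `c s` by `w q`, and `w q` by the inputs
of `theta q` and its key. Of these only `d q` depends on A and the old keys; the rest is independent
of them and drops out. -/
theorem det_a_d (hg : P.IsSecureWitness t g) (q : P.Demand) :
    Det g {P.edge (.a q.1.1)} {P.edge (.d q)} := by
  have h1 : Det g {P.edge (.a q.1.1)} ({P.edge (.d q)} ∪ (allB P ∪ newKeys P)) := by
    refine hg.poly.det_trans (hg.det_a q.1.1) (hg.poly.det_of_forall ?_)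
    rintro i (rfl | rfl)
    · exact hg.poly.det_of_subset (by simp)
    · refine hg.poly.det_trans (hg.det_c_w q) (hg.poly.det_mono_right (hg.det_w q) ?_)
      rintro i ((rfl | rfl) | hi)
      · simp
      · simp
      · exact .inr (.inr hi)
  refine hg.poly.det_drop h1 (hg.poly.ind_left hg.ind_allA_oldKeys
    (hg.poly.det_union (hg.poly.det_of_subset (by simp)) (hg.det_d q)))

/-! ### Conditioning on the keys of the old nodes. -/

/-- The variables of `P` inside those of the secure problem. -/
def embed (P : NetworkProblem V E S) : S ⊕ E → (Unit ⊕ P.SecEdge) ⊕ P.SecNode :=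
  Sum.elim (fun s => P.edge (.a s)) (fun e => P.edge (.old e))


theorem contract_mem_CI (hg : P.IsSecureWitness t g) :
    g.contract (embed P) (oldKeys P) ∈ P.CI := by
  have hA : embed P '' Set.range Sum.inl = allA P := by
    rw [← Set.range_comp]; rfl
  have h1 := hg.ind_allA_keys
  change g (_ ∪ _) - _ = ∑ s, (g (_ ∪ _) - _)
  have h2 : ∀ s, g (embed P '' {Sum.inl s} ∪ oldKeys P) = g {P.edge (.a s)} + g (oldKeys P) := by
    intro s
    rw [Set.image_singleton]
    exact hg.poly.ind_left h1 (hg.poly.det_of_subset (by simp [embed]))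
  rw [Ind] at h1
  simp only [h2, hA, h1, hg.allA_eq_sum, add_sub_cancel_right]

theorem contract_cond (_ : P.IsSecureWitness t g) {α β : Set (S ⊕ E)}
    (h : Det g (embed P '' α) (embed P '' β ∪ oldKeys P)) :
    RankFunction.cond (g.contract (embed P) (oldKeys P)) α β = 0 := by
  rw [RankFunction.cond, RankFunction.contract, RankFunction.contract, Set.image_union]
  rw [Det, ← Set.union_assoc] at h
  rw [h, sub_self]

theorem contract_mem_CT (hg : P.IsSecureWitness t g) :
    g.contract (embed P) (oldKeys P) ∈ P.CT := by
  intro e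
  refine hg.contract_cond ?_
  rw [Set.image_singleton]
  refine hg.det_edge (.old e) ?_ (fun y hy => ?_) ?_
  · simp [secTail]
  · cases y with
    | old f => exact .inl ⟨.inr f, by simpa [inEdge, headOf, secTail, secHead] using hy, rfl⟩
    | a s => exact .inl ⟨.inl s, by simpa [inEdge, headOf, secTail, secHead] using hy, rfl⟩
    | _ => simp [secTail, secHead] at hy
  · exact .inr (by simp [secTail])

/-- The sink u computes `d q` from its inputs and its key, and the key is among the variables
conditioned on. -/
theorem contract_mem_CD (hg : P.IsSecureWitness t g) :
    g.contract (embed P) (oldKeys P) ∈ P.CD := by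
  intro s u hu
  refine hg.contract_cond ?_
  rw [Set.image_singleton]
  refine hg.poly.det_trans (hg.det_a_d ⟨(s, u), hu⟩) ?_
  refine hg.det_edge (.d ⟨(s, u), hu⟩) ?_ (fun y hy => ?_) ?_
  · simp [secTail]
  · cases y with
    | old f => exact .inl ⟨.inr f, by simpa [inNode, headOf, secTail, secHead] using hy, rfl⟩
    | a s => exact .inl ⟨.inl s, by simpa [inNode, headOf, secTail, secHead] using hy, rfl⟩
    | _ => simp [secTail, secHead] at hy
  · exact .inr (by simp [secTail])

/-- Conditioning on the old keys leaves the entropy of `a s` unchanged, by independence, and can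
only lower that of a hyperedge. -/
theorem mem_yeungOuterBound (hg : P.IsSecureWitness t g) (ht : t ∈ rateCapacityTuples S E)
    (ha : g ∈ almostEntropic ((Unit ⊕ P.SecEdge) ⊕ P.SecNode)) : t ∈ P.yeungOuterBound := by
  refine ⟨ht, fun _ => P.proj (g.contract (embed P) (oldKeys P)), fun _ => 1,
    fun _ => ⟨_, ⟨⟨⟨contract_mem_almostEntropic ha _ _, hg.contract_mem_CI⟩,
      hg.contract_mem_CT⟩, hg.contract_mem_CD⟩, rfl⟩, fun _ => one_pos, fun e => ?_, fun s => ?_⟩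
  · refine ⟨_, tendsto_const_nhds, ?_⟩
    have h1 := hg.poly.union_le {P.edge (.old e)} (oldKeys P)
    have h2 : g {P.edge (.old e)} ≤ t.cap e := hg.cap (.old e)
    simp only [proj, RankFunction.contract, Set.image_singleton, embed, Sum.elim_inr, one_mul]
    linarith
  · refine ⟨_, tendsto_const_nhds, ?_⟩
    have h1 := hg.poly.ind_left hg.ind_allA_keys
      (hg.poly.det_of_subset (show {P.edge (.a s)} ⊆ allA P by simp))
    rw [Ind, hg.a_eq] at h1
    simp only [proj, RankFunction.contract, Set.image_singleton, embed, Sum.elim_inl, one_mul]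
    linarith

end IsSecureWitness

/-! ### Normalizing a point of the secure outer bound. -/

variable [Fintype E]

/-- A separate case: without a positive rate the message may have entropy 0, and then the scaling
factors in `CL` need not converge. -/
theorem zero_rate_mem_yeungOuterBound (P : NetworkProblem V E S) {t : RateCapacity S E}
    (ht : t ∈ rateCapacityTuples S E) (h0 : ∀ s, t.rate s ≤ 0) : t ∈ P.yeungOuterBound := by
  refine ⟨ht, fun _ => P.proj 0, fun _ => 1, fun _ => ⟨0, ⟨⟨⟨entropic_subset_almostEntropic
    zero_mem_entropic, ?_⟩, ?_⟩, ?_⟩, rfl⟩, fun _ => one_pos, fun e => ?_, fun s => ?_⟩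
  · simp [CI]
  · simp [CT, RankFunction.cond]
  · simp [CD, RankFunction.cond]
  · exact ⟨_, tendsto_const_nhds, by simpa [proj] using ht.2 e⟩
  · exact ⟨_, tendsto_const_nhds, by simpa [proj] using h0 s⟩

theorem mem_yeungOuterBound_of_secure (P : NetworkProblem V E S) {t : RateCapacity S E}
    (ht : t ∈ rateCapacityTuples S E) (h : P.toSecure.SatisfiesOuterBound (P.toSecureTuple t)) :
    t ∈ P.yeungOuterBound := by
  obtain ⟨g, ⟨⟨⟨⟨ha, hci⟩, hct⟩, hcd⟩, hcs⟩, -, r, c, hr, hc, hcap, hrate⟩ := h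
  by_cases h0 : ∀ s, t.rate s ≤ 0
  · exact P.zero_rate_mem_yeungOuterBound ht h0
  push Not at h0
  obtain ⟨s₀, hs₀⟩ := h0
  have hpos : 0 < ∑ s, t.rate s :=
    Finset.sum_pos' (fun s _ => ht.1 s) ⟨s₀, Finset.mem_univ _, hs₀⟩
  obtain rfl : r = fun _ => P.toSecure.proj g := funext fun n => by simpa using hr n
  obtain ⟨l, hl, hle⟩ := hrate ()
  have hle : ∑ s, t.rate s ≤ l := hle
  have hl : Tendsto (fun n => c n * g {P.msg}) atTop (𝓝 l) := hl
  have hg := almostEntropic.isPolymatroid ha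
  have hm : g {P.msg} ≠ 0 := by
    intro h
    simp only [h, mul_zero] at hl
    have := tendsto_nhds_unique hl tendsto_const_nhds
    linarith
  -- `CL` is taken of a single tuple, so convergence of the scaled rate makes the factors themselves
  -- converge, to `d`; the rescaled function `d • g` then meets the bounds directly.
  set d := l / g {P.msg} with hd
  have hc' : Tendsto c atTop (𝓝 d) := by
    refine (hl.div_const _).congr fun n => ?_
    rw [mul_div_cancel_right₀ _ hm]
  have hd0 : 0 ≤ d := ge_of_tendsto' hc' fun n => (hc n).le
  have hw : P.IsSecureWitness t (d • g) :=
  { poly := hg.smul hd0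
    ci := by
      have := hci
      simp only [SecureProblem.CI, Set.mem_ofPred_eq] at this ⊢
      simp only [Pi.smul_apply, smul_eq_mul, this, mul_add, Finset.mul_sum]
    ct := fun e => by
      have := hct e
      simp only [RankFunction.cond, Pi.smul_apply, smul_eq_mul, ← mul_sub] at this ⊢
      rw [this, mul_zero]
    cd := fun s u hu => by
      have := hcd s u hu
      simp only [RankFunction.cond, Pi.smul_apply, smul_eq_mul, ← mul_sub] at this ⊢
      rw [this, mul_zero]
    cs := fun r => by
      have := hcs r
      simp only [RankFunction.mutualInfo, Pi.smul_apply, smul_eq_mul, ← mul_sub,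
        ← mul_add] at this ⊢
      rw [this, mul_zero]
    rate := by
      simp only [Pi.smul_apply, smul_eq_mul, hd]
      rwa [div_mul_cancel₀ _ hm]
    cap := fun x => by
      obtain ⟨m, hm, hmle⟩ := hcap x
      exact (tendsto_nhds_unique (hc'.mul_const _) hm).trans_le hmle }
  exact hw.mem_yeungOuterBound ht (almostEntropic_smul ha hd0)

end NetworkProblem

/-! # Zero-error codes as functions of the sources -/

namespace NetworkProblem

variable {V E S : Type*}

/-- A zero-error code, given by the messages on the hyperedges as functions of the sources. -/
structure BlockCode (P : NetworkProblem V E S) (A : S → Type) where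
  B : E → Type
  F : (e : E) → (∀ s, A s) → B e
  encode : ∀ e x x', (∀ s, P.tail e ∈ P.O s → x s = x' s) →
    (∀ f, P.tail e ∈ P.head f → F f x = F f x') → F e x = F e x'
  decode : ∀ s, ∀ u ∈ P.D s, ∀ x x' : ∀ s, A s, (∀ i, u ∈ P.O i → x i = x' i) →
    (∀ f, u ∈ P.head f → F f x = F f x') → x s = x' s

/-- Independence gives every combination of supported source symbols positive probability; picking
one outcome for each makes all messages functions of the sources. -/
theorem IsNetworkCode.exists_blockCode [Fintype S] {P : NetworkProblem V E S}
    {X : RandomVars (S ⊕ E)} (hX : P.IsNetworkCode X)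
    (hd : ∀ s, ∀ u ∈ P.D s, RankFunction.cond X.entropy {Sum.inl s} (P.inNode u) = 0) :
    ∃ C : P.BlockCode (fun s => X.supp (Sum.inl s)),
      ∀ e, Nat.card (Set.range (C.F e)) ≤ (X.supp (Sum.inr e)).ncard := by
  have hω : ∀ x : ∀ s, X.supp (Sum.inl s), ∃ ω ∈ X.prob.support, ∀ s,
      X.Y (Sum.inl s) ω = x s := by
    intro x
    have h1 := hX.2.1 fun s => x s
    have h2 : (∏ s, X.prob.map (X.Y (Sum.inl s)) (x s)) ≠ 0 :=
      Finset.prod_ne_zero_iff.2 fun s _ => (PMF.mem_support_iff _ _).1 (x s).2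
    rw [← h1, ← PMF.mem_support_iff, PMF.mem_support_map_iff] at h2
    obtain ⟨ω, hω, h⟩ := h2
    exact ⟨ω, hω, fun s => congrFun h s⟩
  choose ω hω hs using hω
  refine ⟨⟨fun e => X.alphabet (Sum.inr e), fun e x => X.Y (Sum.inr e) (ω x), ?_, ?_⟩, ?_⟩
  · intro e x x' h1 h2
    obtain ⟨φ, hφ⟩ := hX.2.2 e
    rw [hφ _ (hω x), hφ _ (hω x')]
    congr 1
    funext f
    obtain ⟨(s | f), hf⟩ := f
    · change X.Y (Sum.inl s) _ = X.Y (Sum.inl s) _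
      rw [hs, hs, h1 s hf]
    · exact h2 f hf
  · intro s u hu x x' h1 h2
    have h3 := (X.cond_entropy_eq_zero_iff _ _).1 (hd s u hu) _ (hω x) _ (hω x') ?_ _ rfl
    · rw [hs, hs] at h3
      exact Subtype.ext h3
    · rintro (s | f) hf
      · rw [hs, hs, h1 s hf]
      · exact h2 f hf
  · intro e
    have hfin : (X.supp (Sum.inr e)).Finite := by
      rw [RandomVars.supp, PMF.support_map]
      exact Set.toFinite _
    refine Set.ncard_le_ncard ?_ hfin
    rintro _ ⟨x, rfl⟩
    rw [RandomVars.supp, PMF.mem_support_map_iff]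
    exact ⟨ω x, hω x, rfl⟩

namespace BlockCode

variable {P : NetworkProblem V E S} {A A' : S → Type}

/-- The `k`-fold repetition of a code, with the sources restricted to subsets. -/
def power (C : P.BlockCode A) {k : ℕ} (ι : ∀ s, A' s → Fin k → A s)
    (hι : ∀ s, Function.Injective (ι s)) : P.BlockCode A' where
  B e := Fin k → C.B e
  F e x j := C.F e fun s => ι s (x s) j
  encode e x x' h1 h2 := funext fun j =>
    C.encode e _ _ (fun s hs => by rw [h1 s hs]) (fun f hf => congrFun (h2 f hf) j)
  decode s u hu x x' h1 h2 := hι s <| funext fun j =>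
    C.decode s u hu (fun s => ι s (x s) j) (fun s => ι s (x' s) j)
      (fun s hs => by rw [h1 s hs]) (fun f hf => congrFun (h2 f hf) j)

theorem card_range_power [Finite S] [∀ s, Finite (A s)] (C : P.BlockCode A) {k : ℕ}
    (ι : ∀ s, A' s → Fin k → A s) (hι : ∀ s, Function.Injective (ι s)) (e : E) :
    Nat.card (Set.range ((C.power ι hι).F e)) ≤ Nat.card (Set.range (C.F e)) ^ k := by
  have h : Nat.card (Fin k → Set.range (C.F e)) = Nat.card (Set.range (C.F e)) ^ k := by
    rw [Nat.card_fun, Nat.card_fin]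
  rw [← h]
  refine Nat.card_le_card_of_injective
    (fun y j => ⟨y.1 j, by obtain ⟨_, x, rfl⟩ := y; exact ⟨_, rfl⟩⟩) ?_
  intro y y' h
  refine Subtype.ext (funext fun j => ?_)
  exact congrArg Subtype.val (congrFun h j)

/-! # The secure code -/

variable [∀ s, AddCommGroup (A s)]

/-- The partitions of the pairs of a message and a one-time pad that describe the secure code. -/
def partition (C : P.BlockCode A) :
    (Unit ⊕ P.SecEdge) ⊕ P.SecNode → Setoid ((∀ s, A s) × (∀ s, A s))
  -- `ω.1` is the message and `ω.2` the pad, which is the key of `phi`; the other keys are trivial.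
  -- The code of `P` runs on the pad.
  | .inl (.inl _) => Setoid.ker Prod.fst
  | .inl (.inr (.old e)) => Setoid.ker fun ω => C.F e ω.2
  | .inl (.inr (.a s)) => Setoid.ker fun ω => ω.2 s
  | .inl (.inr (.b s)) => Setoid.ker fun ω => ω.1 s + ω.2 s
  | .inl (.inr (.c s)) => Setoid.ker fun ω => ω.1 s
  | .inl (.inr (.e s)) => Setoid.ker fun ω (i : {i // i ≠ s}) => ω.1 i
  | .inl (.inr (.d q)) => Setoid.ker fun ω => ω.2 q.1.1
  | .inl (.inr (.w q)) => Setoid.ker fun ω => ω.1 q.1.1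
  | .inr .phi => Setoid.ker Prod.snd
  | .inr _ => ⊤

variable [Fintype S] [∀ s, Fintype (A s)]

/-- The random variables of the secure code. -/
def secureVars [DecidableEq S] (C : P.BlockCode A) : RandomVars ((Unit ⊕ P.SecEdge) ⊕ P.SecNode) :=
  RandomVars.ofSetoids
    (fun _ => (Fintype.card ((∀ s, A s) × (∀ s, A s)) : ℝ)⁻¹)
    (fun _ => by positivity)
    (by rw [Finset.sum_const, Finset.card_univ, nsmul_eq_mul, mul_inv_cancel₀ (by positivity)])
    C.partition

/-- The rates and capacities that a code uses. -/
def tuple (C : P.BlockCode A) : RateCapacity S E where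
  rate s := Real.log (Fintype.card (A s))
  cap e := Real.log (Nat.card (Set.range (C.F e)))

variable [DecidableEq S] (C : P.BlockCode A)

theorem secureVars_cond {α β : Set ((Unit ⊕ P.SecEdge) ⊕ P.SecNode)}
    (h : ∀ ω ω', (∀ i ∈ β, C.partition i ω ω') → ∀ i ∈ α, C.partition i ω ω') :
    RankFunction.cond C.secureVars.entropy α β = 0 := by
  rw [RandomVars.cond_entropy_eq_zero_iff]
  intro ω _ ω' _ h1 i hi
  exact RandomVars.ofSetoids_Y_eq_iff.2
    (h _ _ (fun i hi => RandomVars.ofSetoids_Y_eq_iff.1 (h1 i hi)) i hi)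

theorem secureVars_entropy {T : Type*} [AddCommGroup T] [Fintype T]
    {α : Set ((Unit ⊕ P.SecEdge) ⊕ P.SecNode)} (f : ((∀ s, A s) × (∀ s, A s)) →+ T)
    (hf : Function.Surjective f)
    (h : ∀ ω ω', (∀ i ∈ α, C.partition i ω ω') ↔ f ω = f ω') :
    C.secureVars.entropy α = Real.log (Fintype.card T) := by
  rw [secureVars, RandomVars.ofSetoids_entropy, ← SetoidEntropy.ent_uniform_hom f hf]
  congr 1
  ext ω ω'
  rw [Setoid.biInf_apply]
  exact h ω ω'

theorem secureVars_logSupp {T : Type*} {i : (Unit ⊕ P.SecEdge) ⊕ P.SecNode}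
    (f : ((∀ s, A s) × (∀ s, A s)) → T) (h : C.partition i = Setoid.ker f) :
    C.secureVars.logSupp i = Real.log (Nat.card (Set.range f)) := by
  rw [RandomVars.logSupp, secureVars, RandomVars.ofSetoids_ncard_supp (fun _ => by positivity), h,
    Nat.card_congr (Setoid.quotientKerEquivRange f)]

theorem secureVars_logSupp_surjective {T : Type*} [Fintype T]
    {i : (Unit ⊕ P.SecEdge) ⊕ P.SecNode}
    (f : ((∀ s, A s) × (∀ s, A s)) → T) (h : C.partition i = Setoid.ker f)
    (hf : Function.Surjective f) : C.secureVars.logSupp i = Real.log (Fintype.card T) := by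
  rw [C.secureVars_logSupp f h, hf.range_eq, Nat.card_coe_set_eq, Set.ncard_univ,
    Nat.card_eq_fintype_card]

theorem log_card_pi {ι : Type*} [Fintype ι] [DecidableEq ι] (A : ι → Type*) [∀ i, Fintype (A i)]
    [∀ i, Nonempty (A i)] :
    Real.log (Fintype.card (∀ i, A i)) = ∑ i, Real.log (Fintype.card (A i)) := by
  rw [Fintype.card_pi, Nat.cast_prod, Real.log_prod]
  intro i _
  exact_mod_cast Fintype.card_ne_zero

theorem secureVars_rate :
    C.secureVars.logSupp P.msg = (P.toSecureTuple C.tuple).rate () := by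
  rw [C.secureVars_logSupp_surjective (i := P.msg) Prod.fst rfl Prod.fst_surjective, log_card_pi]
  rfl

theorem secureVars_cap (x : P.SecEdge) :
    C.secureVars.logSupp (P.edge x) = (P.toSecureTuple C.tuple).cap x := by
  have hsurj : ∀ s, Function.Surjective fun ω : (∀ s, A s) × (∀ s, A s) => ω.1 s :=
    fun s => (Function.surjective_eval s).comp Prod.fst_surjective
  have hsurj' : ∀ s, Function.Surjective fun ω : (∀ s, A s) × (∀ s, A s) => ω.2 s :=
    fun s => (Function.surjective_eval s).comp Prod.snd_surjective
  cases x with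
  | old e =>
    rw [C.secureVars_logSupp (i := P.edge (.old e)) (fun ω => C.F e ω.2) rfl]
    change _ = Real.log (Nat.card (Set.range (C.F e)))
    rw [← (Prod.snd_surjective (α := ∀ s, A s) (β := ∀ s, A s)).range_comp (C.F e)]
    rfl
  | a s => exact C.secureVars_logSupp_surjective (i := P.edge (.a s)) _ rfl (hsurj' s)
  | b s =>
    refine C.secureVars_logSupp_surjective (i := P.edge (.b s)) _ rfl fun y => ?_
    obtain ⟨ω, h⟩ := hsurj s y
    exact ⟨(ω.1, 0), by simpa using h⟩
  | c s => exact C.secureVars_logSupp_surjective (i := P.edge (.c s)) _ rfl (hsurj s)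
  | e s =>
    rw [C.secureVars_logSupp_surjective (i := P.edge (.e s)) _ rfl, log_card_pi]
    · simp only [toSecureTuple, tuple]
      rw [← Finset.sum_subtype (p := fun i => i ≠ s) (s := Finset.univ.erase s) (by simp)
        (fun i => Real.log (Fintype.card (A i)))]
      congr
      exact Subsingleton.elim _ _
    · intro y
      refine ⟨(fun i => if h : i ≠ s then y ⟨i, h⟩ else 0, 0), ?_⟩
      funext i
      simp [i.2]
  | d q => exact C.secureVars_logSupp_surjective (i := P.edge (.d q)) _ rfl (hsurj' q.1.1)
  | w q => exact C.secureVars_logSupp_surjective (i := P.edge (.w q)) _ rfl (hsurj q.1.1)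

theorem secureVars_isUniform : C.secureVars.IsUniform P.msg := by
  classical
  refine RandomVars.ofSetoids_isUniform fun ω ω' => ?_
  rw [SetoidEntropy.mass, SetoidEntropy.mass,
    -- Translation by `ω' - ω` carries the class of `ω` onto that of `ω'`.
    ← Equiv.sum_comp (Equiv.addRight (ω' - ω))
      (fun x => if C.partition P.msg ω' x then
        (Fintype.card ((∀ s, A s) × (∀ s, A s)) : ℝ)⁻¹ else 0)]
  refine Finset.sum_congr rfl fun x _ => if_congr ?_ rfl rfl
  change ω.1 = x.1 ↔ ω'.1 = x.1 + (ω'.1 - ω.1)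
  constructor
  · intro h; rw [h]; abel
  · intro h
    rw [show x.1 + (ω'.1 - ω.1) = ω'.1 + (x.1 - ω.1) by abel] at h
    exact (sub_eq_zero.1 (left_eq_add.1 h)).symm

theorem entropy_msg : C.secureVars.entropy {P.msg} = Real.log (Fintype.card (∀ s, A s)) := by
  refine C.secureVars_entropy (AddMonoidHom.fst _ _) Prod.fst_surjective fun ω ω' => ?_
  simp only [Set.mem_singleton_iff, forall_eq]
  rfl

theorem log_card_prod : Real.log (Fintype.card ((∀ s, A s) × (∀ s, A s))) =
    Real.log (Fintype.card (∀ s, A s)) + Real.log (Fintype.card (∀ s, A s)) := by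
  have : (Fintype.card (∀ s, A s) : ℝ) ≠ 0 := by exact_mod_cast Fintype.card_ne_zero
  rw [Fintype.card_prod, Nat.cast_mul, Real.log_mul this this]

theorem secureVars_mem_CI [Fintype V] : C.secureVars.entropy ∈ P.toSecure.CI := by
  have h1 : C.secureVars.entropy ({P.msg} ∪ Set.range P.key) =
      Real.log (Fintype.card ((∀ s, A s) × (∀ s, A s))) := by
    refine C.secureVars_entropy (AddMonoidHom.id _) Function.surjective_id fun ω ω' => ?_
    constructor
    · intro h
      exact Prod.ext (h P.msg (.inl rfl)) (h (P.key .phi) (.inr ⟨_, rfl⟩))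
    · rintro rfl i _
      exact Setoid.refl' _ _
  have h2 : ∑ u, C.secureVars.entropy {P.key u} = Real.log (Fintype.card (∀ s, A s)) := by
    rw [Finset.sum_eq_single SecNode.phi]
    · refine C.secureVars_entropy (AddMonoidHom.snd _ _) Prod.snd_surjective fun ω ω' => ?_
      simp only [Set.mem_singleton_iff, forall_eq]
      rfl
    · intro u _ hu
      rw [C.secureVars_entropy (0 : _ →+ Unit) (fun y => ⟨0, rfl⟩)]
      · simp
      · intro ω ω'
        simp only [Set.mem_singleton_iff, forall_eq]
        cases u <;> first | exact absurd rfl hu | exact iff_of_true trivial trivial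
    · simp
  simp only [SecureProblem.CI, Set.mem_ofPred_eq]
  rw [range_msg]
  change C.secureVars.entropy ({P.msg} ∪ Set.range P.key) = _ + ∑ u, C.secureVars.entropy {P.key u}
  rw [h1, h2, log_card_prod, ← C.entropy_msg]
  simp

theorem secureVars_mem_CT : C.secureVars.entropy ∈ P.toSecure.CT := by
  intro x
  refine C.secureVars_cond fun ω ω' h => ?_
  simp only [Set.mem_singleton_iff, forall_eq]
  have hm : P.secTail x = .phi → ω.1 = ω'.1 ∧ ω.2 = ω'.2 := fun hx =>
    ⟨h P.msg (.inl ⟨.inl (), hx, rfl⟩), h (P.key .phi) (.inr (by rw [← hx]; rfl))⟩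
  have he : ∀ y, P.secTail x ∈ P.secHead y → C.partition (P.edge y) ω ω' := fun y hy =>
    h (P.edge y) (.inl ⟨.inr y, hy, rfl⟩)
  cases x with
  | old e =>
    refine C.encode e _ _ (fun s hs => ?_) (fun f hf => ?_)
    · exact he (.a s) (by simpa [secTail, secHead] using hs)
    · exact he (.old f) (by simpa [secTail, secHead] using hf)
  | a s => exact congrFun (hm rfl).2 s
  | b s => exact congrArg₂ (· + ·) (congrFun (hm rfl).1 s) (congrFun (hm rfl).2 s)
  | c s =>
    have h1 : ω.2 s = ω'.2 s := he (.a s) (by simp [secTail, secHead])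
    have h2 : ω.1 s + ω.2 s = ω'.1 s + ω'.2 s := he (.b s) (by simp [secTail, secHead])
    rw [h1] at h2
    exact add_right_cancel h2
  | e s => exact funext fun i => congrFun (hm rfl).1 i
  | d q =>
    refine C.decode q.1.1 q.1.2 q.2 _ _ (fun s hs => ?_) (fun f hf => ?_)
    · exact he (.a s) (by simpa [secTail, secHead] using hs)
    · exact he (.old f) (by simpa [secTail, secHead] using hf)
  | w q =>
    have h1 : ω.2 q.1.1 = ω'.2 q.1.1 := he (.d q) (by simp [secTail, secHead])
    have h2 : ω.1 q.1.1 + ω.2 q.1.1 = ω'.1 q.1.1 + ω'.2 q.1.1 :=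
      he (.b q.1.1) (by simp [secTail, secHead])
    rw [h1] at h2
    exact add_right_cancel h2

theorem secureVars_decode {u : P.SecNode} (hu : u ∈ P.toSecure.D ()) :
    RankFunction.cond C.secureVars.entropy {P.msg} (Sum.inl '' P.toSecure.inNode u) = 0 := by
  refine C.secureVars_cond fun ω ω' h => ?_
  simp only [Set.mem_singleton_iff, forall_eq]
  have he : ∀ y, u ∈ P.secHead y → C.partition (P.edge y) ω ω' := fun y hy =>
    h (P.edge y) ⟨.inr y, hy, rfl⟩
  change ω.1 = ω'.1
  have hce : ∀ s, ω.1 s = ω'.1 s → u ∈ P.secHead (.e s) → ω.1 = ω'.1 := by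
    intro s hs hu
    funext i
    by_cases hi : i = s
    · rw [hi, hs]
    · have h1 : (fun i : {i // i ≠ s} => ω.1 i.1) = fun i : {i // i ≠ s} => ω'.1 i.1 :=
        he (.e s) hu
      exact congrFun h1 ⟨i, hi⟩
  rcases hu with (⟨q, rfl⟩ | ⟨s, rfl⟩) | rfl
  · exact hce q.1.1 (he (.w q) (by simp [secHead])) (by simp [secHead])
  · exact hce s (he (.c s) (by simp [secHead])) (by simp [secHead])
  · funext s
    have h1 : ω.2 s = ω'.2 s := he (.a s) (by simp [secHead])
    have h2 : ω.1 s + ω.2 s = ω'.1 s + ω'.2 s := he (.b s) (by simp [secHead])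
    rw [h1] at h2
    exact add_right_cancel h2

/-- Each wiretapper sees a surjective homomorphic image of the uniform pair, K or M + K, that
together with M determines the pair; the entropies of M and of the observation therefore add up. -/
theorem secureVars_secret (r : Fin 2) : RankFunction.mutualInfo C.secureVars.entropy
    ((fun s => Sum.inl (Sum.inl s)) '' P.toSecure.A r)
    ((fun e => Sum.inl (Sum.inr e)) '' P.toSecure.B r) = 0 := by
  have key : ∀ (x : S → P.SecEdge)
      (f : ((∀ s, A s) × (∀ s, A s)) →+ (∀ s, A s)) (_ : Function.Surjective f)
      (_ : ∀ ω ω', (∀ s, C.partition (P.edge (x s)) ω ω') ↔ f ω = f ω')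
      (_ : ∀ ω ω', ω.1 = ω'.1 → f ω = f ω' → ω = ω'),
      C.secureVars.entropy {P.msg} + C.secureVars.entropy (Set.range fun s => P.edge (x s)) -
        C.secureVars.entropy ({P.msg} ∪ Set.range fun s => P.edge (x s)) = 0 := by
    intro x f hf h hinj
    rw [C.entropy_msg, C.secureVars_entropy f hf,
      C.secureVars_entropy (AddMonoidHom.id _) Function.surjective_id, log_card_prod, sub_self]
    · intro ω ω'
      constructor
      · intro h1
        exact hinj ω ω' (h1 P.msg (.inl rfl)) ((h ω ω').1 fun s => h1 _ (.inr ⟨s, rfl⟩))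
      · rintro rfl i _
        exact Setoid.refl' _ _
    · intro ω ω'
      rw [← h, Set.forall_mem_range]
  match r with
  | 0 =>
    change C.secureVars.entropy (_ '' Set.univ) +
      C.secureVars.entropy (_ '' Set.range SecEdge.a) -
      C.secureVars.entropy (_ '' Set.univ ∪ _ '' Set.range SecEdge.a) = 0
    rw [Set.image_univ, range_msg, ← Set.range_comp]
    exact key SecEdge.a (AddMonoidHom.snd _ _) Prod.snd_surjective
      (fun ω ω' => funext_iff.symm) (fun ω ω' h1 h2 => Prod.ext h1 h2)
  | 1 =>
    change C.secureVars.entropy (_ '' Set.univ) +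
      C.secureVars.entropy (_ '' Set.range SecEdge.b) -
      C.secureVars.entropy (_ '' Set.univ ∪ _ '' Set.range SecEdge.b) = 0
    rw [Set.image_univ, range_msg, ← Set.range_comp]
    refine key SecEdge.b (AddMonoidHom.fst _ _ + AddMonoidHom.snd _ _)
      (fun y => ⟨(y, 0), by simp⟩) (fun ω ω' => funext_iff.symm) (fun ω ω' h1 h2 => ?_)
    have h3 : ω.1 + ω.2 = ω'.1 + ω'.2 := h2
    rw [h1] at h3
    exact Prod.ext h1 (add_left_cancel h3)

end BlockCode

/-! # Choice of rates and passage to the limit -/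

/-- With n the floor, n ≥ 1 gives exp x < n + 1 ≤ 2n. -/
theorem sub_log_two_le_log_floor_exp {x : ℝ} (hx : 0 ≤ x) :
    x - Real.log 2 ≤ Real.log (⌊Real.exp x⌋₊ : ℝ) := by
  have h1 : (1 : ℝ) ≤ ⌊Real.exp x⌋₊ := by
    exact_mod_cast Nat.le_floor (by simpa using Real.one_le_exp hx)
  have h2 := Nat.lt_floor_add_one (Real.exp x)
  rw [sub_le_iff_le_add, ← Real.log_mul (by positivity) two_ne_zero,
    Real.le_log_iff_exp_le (by positivity)]
  linarith

/-- The size of a subset of `M` elements for the rate `x`. -/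
def reducedSize (M : ℕ) (x : ℝ) : ℕ := min M ⌊Real.exp x⌋₊

theorem reducedSize_pos {M : ℕ} (hM : 0 < M) {x : ℝ} (hx : 0 ≤ x) : 0 < reducedSize M x :=
  lt_min hM (Nat.floor_pos.2 (Real.one_le_exp hx))

theorem log_reducedSize_le {M : ℕ} (hM : 0 < M) {x : ℝ} (hx : 0 ≤ x) :
    Real.log (reducedSize M x) ≤ x := by
  rw [Real.log_le_iff_le_exp (by exact_mod_cast reducedSize_pos hM hx)]
  exact (Nat.cast_le.2 (min_le_right _ _)).trans (Nat.floor_le (Real.exp_pos x).le)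

theorem le_log_reducedSize {M : ℕ} {x : ℝ} (hx : 0 ≤ x) :
    min (Real.log M) (x - Real.log 2) ≤ Real.log (reducedSize M x) := by
  rcases min_choice M ⌊Real.exp x⌋₊ with h | h
  · rw [reducedSize, h]; exact min_le_left _ _
  · rw [reducedSize, h]; exact (min_le_right _ _).trans (sub_log_two_le_log_floor_exp hx)

/-- A sandwich: the rounding loss log 2 vanishes since `c` tends to 0, and the cap by `M n` is
harmless in the limit since `x ≤ l`. -/
theorem tendsto_mul_log_reducedSize {M : ℕ → ℕ} (hM : ∀ n, 0 < M n) {c : ℕ → ℝ}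
    (hc : ∀ n, 0 < c n) (hc0 : Tendsto c atTop (𝓝 0)) {l x : ℝ} (hx : 0 ≤ x) (hl : x ≤ l)
    (h : Tendsto (fun n => c n * Real.log (M n)) atTop (𝓝 l)) :
    Tendsto (fun n => c n * Real.log (reducedSize (M n) (x / c n))) atTop (𝓝 x) := by
  have h1 : Tendsto (fun n => min (c n * Real.log (M n)) (x - c n * Real.log 2)) atTop (𝓝 x) := by
    have := h.min (tendsto_const_nhds (x := x) |>.sub (hc0.mul_const (Real.log 2)))
    rwa [zero_mul, sub_zero, min_eq_right hl] at this
  refine tendsto_of_tendsto_of_tendsto_of_le_of_le h1 tendsto_const_nhds (fun n => ?_) fun n => ?_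
  · have := mul_le_mul_of_nonneg_left
      (le_log_reducedSize (M := M n) (div_nonneg hx (hc n).le)) (hc n).le
    rwa [mul_min_of_nonneg _ _ (hc n).le, mul_sub, mul_div_cancel₀ _ (hc n).ne'] at this
  · have := mul_le_mul_of_nonneg_left
      (log_reducedSize_le (hM n) (div_nonneg hx (hc n).le)) (hc n).le
    rwa [mul_div_cancel₀ _ (hc n).ne'] at this

variable [Fintype V] [Fintype E] [Fintype S]

/-- Codes whose normalized rates tend to the prescribed ones and whose normalized capacities are
bounded by convergent sequences. -/
theorem ZeroErrorAchievable.exists_blockCodes {P : NetworkProblem V E S} {t : RateCapacity S E}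
    (ht : t ∈ rateCapacityTuples S E) (h : P.ZeroErrorAchievable t) :
    ∃ (m : ℕ → S → ℕ) (_ : ∀ n s, NeZero (m n s)) (C : ∀ n, P.BlockCode fun s => ZMod (m n s))
      (c : ℕ → ℝ) (b : ℕ → E → ℝ), (∀ n, 0 < c n) ∧
      (∀ s, Tendsto (fun n => c n * (C n).tuple.rate s) atTop (𝓝 (t.rate s))) ∧
      (∀ e n, 0 ≤ c n * (C n).tuple.cap e ∧ c n * (C n).tuple.cap e ≤ b n e) ∧
      ∀ e, ∃ l, Tendsto (fun n => b n e) atTop (𝓝 l) ∧ l ≤ t.cap e := by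
  obtain ⟨X, c, hX, hc, hrate, hcap, hdec⟩ := h
  choose C hC using fun n => (hX n).exists_blockCode (hdec n)
  have hfin : ∀ n i, ((X n).supp i).Finite := fun n i => by
    rw [RandomVars.supp, PMF.support_map]
    exact Set.toFinite _
  have hpos : ∀ n i, 0 < ((X n).supp i).ncard := fun n i =>
    (Set.ncard_pos (hfin n i)).2 (PMF.support_nonempty _)
  have hfin' : ∀ n s, Finite ((X n).supp (Sum.inl s)) := fun n s => (hfin n _).to_subtype
  -- The given factors `c n` need not tend to 0. Repeating the code `k n` times replaces them by `c
  -- n / k n ≤ 1 / (n + 1)`, so that rounding alphabet sizes is negligible.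
  let k : ℕ → ℕ := fun n => ⌈c n * ((n : ℝ) + 1)⌉₊
  have hk : ∀ n, 0 < k n := fun n => Nat.ceil_pos.2 (mul_pos (hc n) (by positivity))
  have hk' : ∀ n, (0 : ℝ) < k n := fun n => by exact_mod_cast hk n
  let c' : ℕ → ℝ := fun n => c n / k n
  have hc' : ∀ n, 0 < c' n := fun n => div_pos (hc n) (hk' n)
  have hck : ∀ n x, c' n * (k n * x) = c n * x := fun n x => by
    have := (hk' n).ne'
    simp only [c']
    field_simp
  have hc0 : Tendsto c' atTop (𝓝 0) := by
    refine tendsto_of_tendsto_of_tendsto_of_le_of_le tendsto_const_nhds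
      tendsto_one_div_add_atTop_nhds_zero_nat (fun n => (hc' n).le) fun n => ?_
    simp only [c']
    rw [div_le_div_iff₀ (hk' n) (by positivity), one_mul]
    exact Nat.le_ceil _
  let M : ℕ → S → ℕ := fun n s => ((X n).supp (Sum.inl s)).ncard ^ k n
  have hM : ∀ n s, 0 < M n s := fun n s => pow_pos (hpos n _) _
  -- The original rates may tend to more than `t.rate s`, but in the secure problem the same rate is
  -- also a capacity demand, on `a s` for instance; so it is cut down to the exact limit.
  let m : ℕ → S → ℕ := fun n s => reducedSize (M n s) (t.rate s / c' n)
  have hm : ∀ n s, NeZero (m n s) := fun n s =>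
    ⟨(reducedSize_pos (hM n s) (div_nonneg (ht.1 s) (hc' n).le)).ne'⟩
  have hι : ∀ n s, ∃ ι : ZMod (m n s) → Fin (k n) → (X n).supp (Sum.inl s),
      Function.Injective ι := by
    intro n s
    have : Fintype ((X n).supp (Sum.inl s)) := Fintype.ofFinite _
    have h1 : Fintype.card (ZMod (m n s)) ≤
        Fintype.card (Fin (k n) → (X n).supp (Sum.inl s)) := by
      rw [ZMod.card, Fintype.card_fun, Fintype.card_fin, ← Nat.card_eq_fintype_card,
        Nat.card_coe_set_eq]
      exact min_le_left _ _
    obtain ⟨ι⟩ := Function.Embedding.nonempty_of_card_le h1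
    exact ⟨ι, ι.injective⟩
  choose ι hι using hι
  refine ⟨m, hm, fun n => (C n).power (ι n) (hι n), c',
    fun n e => c n * (X n).logSupp (Sum.inr e), hc', fun s => ?_, fun e n => ?_, hcap⟩
  · obtain ⟨l, hl, hle⟩ := hrate s
    have := tendsto_mul_log_reducedSize (M := fun n => M n s) (fun n => hM n s) hc' hc0 (ht.1 s)
      hle (hl.congr fun n => by
        rw [Nat.cast_pow, Real.log_pow, hck]
        rfl)
    refine this.congr fun n => ?_
    simp only [BlockCode.tuple, ZMod.card]
    rfl
  · have h1 : 0 < Nat.card (Set.range (((C n).power (ι n) (hι n)).F e)) := Nat.card_pos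
    have h2 := ((C n).card_range_power (ι n) (hι n) e).trans (Nat.pow_le_pow_left (hC n e) (k n))
    refine ⟨mul_nonneg (hc' n).le (Real.log_natCast_nonneg _), ?_⟩
    change c' n * _ ≤ c n * _
    rw [← hck n]
    refine mul_le_mul_of_nonneg_left ?_ (hc' n).le
    rw [RandomVars.logSupp, ← Real.log_pow]
    exact Real.log_le_log (by exact_mod_cast h1) (by exact_mod_cast h2)

theorem tendsto_toSecureTuple_cap (P : NetworkProblem V E S) {r : ℕ → RateCapacity S E}
    {t : RateCapacity S E} {c : ℕ → ℝ}
    (hr : ∀ s, Tendsto (fun n => c n * (r n).rate s) atTop (𝓝 (t.rate s)))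
    (hc : ∀ e, ∃ l, Tendsto (fun n => c n * (r n).cap e) atTop (𝓝 l) ∧ l ≤ t.cap e)
    (x : P.SecEdge) : ∃ l, Tendsto (fun n => c n * (P.toSecureTuple (r n)).cap x) atTop (𝓝 l) ∧
      l ≤ (P.toSecureTuple t).cap x := by
  cases x with
  | old e => exact hc e
  | a s => exact ⟨_, hr s, le_rfl⟩
  | b s => exact ⟨_, hr s, le_rfl⟩
  | c s => exact ⟨_, hr s, le_rfl⟩
  | e s =>
    refine ⟨_, ?_, le_rfl⟩
    simp only [toSecureTuple, Finset.mul_sum]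
    exact tendsto_finsetSum _ fun i _ => hr i
  | d q => exact ⟨_, hr q.1.1, le_rfl⟩
  | w q => exact ⟨_, hr q.1.1, le_rfl⟩

theorem stronglySecureAchievable_of_zeroError (P : NetworkProblem V E S) {t : RateCapacity S E}
    (ht : t ∈ rateCapacityTuples S E) (h : P.ZeroErrorAchievable t) :
    P.toSecure.StronglySecureAchievable (P.toSecureTuple t) := by
  classical
  obtain ⟨m, hm, C, c, b, hc, hrate, hcap, hb⟩ := h.exists_blockCodes ht
  choose l hl hle using hb
  choose B hB using fun e => (hl e).bddAbove_range
  -- After the reduction the normalized capacities are only bounded by convergent sequences;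
  -- compactness gives a subsequence along which all of them converge.
  obtain ⟨z, -, φ, hφ, hz⟩ := (isCompact_univ_pi fun e : E =>
    isCompact_Icc (a := 0) (b := B e)).tendsto_subseq (x := fun n e => c n * (C n).tuple.cap e)
    (fun n e _ => ⟨(hcap e n).1, (hcap e n).2.trans (hB e ⟨n, rfl⟩)⟩)
  have hz' : ∀ e, Tendsto (fun n => c (φ n) * (C (φ n)).tuple.cap e) atTop (𝓝 (z e)) :=
    fun e => (tendsto_pi_nhds.1 hz) e
  have hr' : ∀ s, Tendsto (fun n => c (φ n) * (C (φ n)).tuple.rate s) atTop (𝓝 (t.rate s)) :=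
    fun s => (hrate s).comp hφ.tendsto_atTop
  refine ⟨fun n => (C (φ n)).secureVars, fun n => c (φ n),
    fun n => ⟨fun _ => (C (φ n)).secureVars_isUniform,
      (C (φ n)).secureVars_mem_CI, (C (φ n)).secureVars_mem_CT⟩, fun n => hc _, fun x => ?_,
    fun _ => ⟨∑ s, t.rate s, ?_, le_rfl⟩, fun n _ u hu => (C (φ n)).secureVars_decode hu,
    fun n r => (C (φ n)).secureVars_secret r⟩
  · obtain ⟨l', h1, h2⟩ := P.tendsto_toSecureTuple_cap hr'
      (fun e => ⟨z e, hz' e, (le_of_tendsto_of_tendsto' (hz' e)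
        ((hl e).comp hφ.tendsto_atTop) fun n => (hcap e _).2).trans (hle e)⟩) x
    exact ⟨l', h1.congr fun n => by rw [(C (φ n)).secureVars_cap], h2⟩
  · refine (tendsto_finsetSum _ fun s _ => hr' s).congr fun n => ?_
    rw [← Finset.mul_sum]
    exact congrArg _ (C (φ n)).secureVars_rate.symm

end NetworkProblem

end

theorem mainTheorem9 {V E S : Type*} [Fintype V] [Fintype E] [Fintype S]
    (P : NetworkProblem V E S) (t : RateCapacity S E) (ht : t ∈ rateCapacityTuples S E) :
    (P.toSecure.SatisfiesOuterBound (P.toSecureTuple t) → t ∈ P.yeungOuterBound) ∧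
    (P.ZeroErrorAchievable t →
      P.toSecure.StronglySecureAchievable (P.toSecureTuple t)) := by
  exact ⟨P.mem_yeungOuterBound_of_secure ht, P.stronglySecureAchievable_of_zeroError ht⟩
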